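/- There is an absolute constant $C>0$ such that the following holds. Let $d,T\ge 1$ be integers, $\sigma>0$, $r\ge 0$, let $\Sigma_0\in\mathbb R^{d\times d}$ be symmetric positive definite, and let $\mathcal A\subset\{a\in\mathbb R^d:\|a\|_2\le r\}$ be an action set with a (measurable) optimal-action map $a_\star(\theta)\in\operatorname{argmax}_{a\in\mathcal A}\theta^\top a$, $\theta\in\mathbb R^d$. Consider the linear-Gaussian bandit in which the unknown parameter is $\theta_\star\sim N(0,\Sigma_0)$ and an action $A_t\in\mathcal A$ taken at time $t=0,1,2,\dots$ yields the reward $R_{t+1}=\theta_\star^\top A_t+W_{t+1}$, where the $W_{t+1}$ are i.i.d. $N(0,\sigma^2)$, each $W_{t+1}$ being independent of $\theta_\star$ and of everything that happens up to the choice of $A_t$. Thompson sampling draws at each time $t$, given the history $H_t=(A_0,R_1,\dots,A_{t-1},R_t)$ and conditionally independently of $\theta_\star$, a vector $\hat\theta_t$ from the conditional distribution of $\theta_\star$ given $H_t$, and plays $A_t=a_\star(\hat\theta_t)$. Then each $\theta_\star^\top a_\star(\theta_\star)-R_{t+1}$ is integrable, and the Bayesian regret $$\mathrm{Reg}(T)=\sum_{t=0}^{T-1}\mathbb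 E\big[\theta_\star^\top a_\star(\theta_\star)-R_{t+1}\big]$$ of Thompson sampling satisfies $$\mathrm{Reg}(T)\le C\,\sqrt{1+\frac{\log T}{d}}\;\sqrt{1+\log\Big(1+\frac{r^2\|\Sigma_0\|_{\mathrm{op}}T}{d\sigma^2}\Big)}\;\Big(\sigma d\sqrt T+d\,r\sqrt{\operatorname{tr}(\Sigma_0)}\Big),$$ that is, $\mathrm{Reg}(T)=\widetilde O\big(\sigma d\sqrt T+dr\sqrt{\operatorname{tr}(\Sigma_0)}\big)$, where $\widetilde O$ hides an absolute constant and a factor that is at most logarithmic in $T$, $r$, $\|\Sigma_0\|_{\mathrm{op}}$, $\sigma^{-1}$ and $1/d$. -/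

import Mathlib

open MeasureTheory ProbabilityTheory

noncomputable section

namespace LinearGaussianBandit

/-- `aStar` is a measurable optimal-action map for the action set `𝒜`:
`aStar θ ∈ argmax_{a ∈ 𝒜} θᵀ a` for every parameter vector `θ`. -/
structure IsOptimalAction {d : ℕ} (𝒜 : Set (EuclideanSpace ℝ (Fin d)))
    (aStar : EuclideanSpace ℝ (Fin d) → EuclideanSpace ℝ (Fin d)) : Prop where
  measurable : Measurable aStar
  mem : ∀ θ, aStar θ ∈ 𝒜
  isMaxOn : ∀ θ, IsMaxOn (fun a => inner ℝ θ a) 𝒜 (aStar θ)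

/-- The reward received after the action at time `t`, i.e. `R_{t+1} = θᵀ A_t + W_{t+1}`. -/
def rewardAfter {d : ℕ} {Ω : Type*} (θ : Ω → EuclideanSpace ℝ (Fin d))
    (A : ℕ → Ω → EuclideanSpace ℝ (Fin d)) (W : ℕ → Ω → ℝ) (t : ℕ) (ω : Ω) : ℝ :=
  inner ℝ (θ ω) (A t ω) + W (t + 1) ω

/-- The history `H_t = (A_0, R_1, …, A_{t-1}, R_t)`, as the tuple of the `t` pairs
`(A_i, R_{i+1})`, `i < t`. -/
def history {d : ℕ} {Ω : Type*} (θ : Ω → EuclideanSpace ℝ (Fin d))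
    (A : ℕ → Ω → EuclideanSpace ℝ (Fin d)) (W : ℕ → Ω → ℝ) (t : ℕ) (ω : Ω) :
    Fin t → EuclideanSpace ℝ (Fin d) × ℝ :=
  fun i => (A i ω, rewardAfter θ A W i ω)

/-- The action that Thompson sampling takes at time `t`: `A_t = a⋆(θ̂_t)`. -/
def thompsonAction {d : ℕ} {Ω : Type*}
    (aStar : EuclideanSpace ℝ (Fin d) → EuclideanSpace ℝ (Fin d))
    (θhat : ℕ → Ω → EuclideanSpace ℝ (Fin d)) (t : ℕ) (ω : Ω) : EuclideanSpace ℝ (Fin d) :=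
  aStar (θhat t ω)

/-- The law of Thompson sampling in the linear-Gaussian bandit with prior `N(0, S₀)`, noise
variance `σ²` and optimal-action map `aStar`. The random variables are the unknown parameter `θ`,
the noise `W_1, W_2, …` (`W 0` is not used) and the posterior samples `θ̂_0, θ̂_1, …`; actions,
rewards and histories are functions of these. -/
structure IsThompsonSampling {d : ℕ} {Ω : Type*} [MeasurableSpace Ω]
    (S₀ : Matrix (Fin d) (Fin d) ℝ) (σ : ℝ)
    (aStar : EuclideanSpace ℝ (Fin d) → EuclideanSpace ℝ (Fin d))
    (P : Measure Ω) [IsProbabilityMeasure P] (θ : Ω → EuclideanSpace ℝ (Fin d))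
    (W : ℕ → Ω → ℝ) (θhat : ℕ → Ω → EuclideanSpace ℝ (Fin d)) : Prop where
  measurable_param : Measurable θ
  measurable_noise : ∀ t, Measurable (W (t + 1))
  measurable_sample : ∀ t, Measurable (θhat t)
  /-- The prior: `θ ∼ N(0, S₀)`. -/
  prior : HasLaw θ (multivariateGaussian 0 S₀) P
  /-- The noise: `W_{t+1} ∼ N(0, σ²)`. -/
  noise : ∀ t, HasLaw (W (t + 1)) (gaussianReal 0 (σ ^ 2).toNNReal) P
  /-- The noise `W_{t+1}` is independent of the parameter and of everything observed or sampled
  up to the choice of `A_t`. As `W_1, …, W_t` are functions of `θ` and `H_t`, this makes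
  `W_1, W_2, …` i.i.d. and independent of `θ`. -/
  noise_indep : ∀ t, IndepFun (W (t + 1))
    (fun ω => ((θ ω, history θ (thompsonAction aStar θhat) W t ω), θhat t ω)) P
  /-- Posterior sampling: given the history `H_t` (and whatever the value of `θ`), the sample
  `θ̂_t` is drawn from the conditional distribution of `θ` given `H_t`. -/
  posterior_sample : ∀ t, HasCondDistrib (θhat t)
    (fun ω => (θ ω, history θ (thompsonAction aStar θhat) W t ω))
    (Kernel.prodMkLeft (EuclideanSpace ℝ (Fin d))
      (condDistrib θ (history θ (thompsonAction aStar θhat) W t) P)) P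

/-- The regret incurred at time `t`: `θᵀ a⋆(θ) - R_{t+1}`. -/
def instantRegret {d : ℕ} {Ω : Type*}
    (aStar : EuclideanSpace ℝ (Fin d) → EuclideanSpace ℝ (Fin d))
    (θ : Ω → EuclideanSpace ℝ (Fin d)) (A : ℕ → Ω → EuclideanSpace ℝ (Fin d))
    (W : ℕ → Ω → ℝ) (t : ℕ) (ω : Ω) : ℝ :=
  inner ℝ (θ ω) (aStar (θ ω)) - rewardAfter θ A W t ω

/-- The Bayesian regret `∑_{t < T} E[θᵀ a⋆(θ) - R_{t+1}]`. -/
def bayesRegret {d : ℕ} {Ω : Type*} [MeasurableSpace Ω]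
    (aStar : EuclideanSpace ℝ (Fin d) → EuclideanSpace ℝ (Fin d))
    (P : Measure Ω) (θ : Ω → EuclideanSpace ℝ (Fin d))
    (A : ℕ → Ω → EuclideanSpace ℝ (Fin d)) (W : ℕ → Ω → ℝ) (T : ℕ) : ℝ :=
  ∑ t ∈ Finset.range T, ∫ ω, instantRegret aStar θ A W t ω ∂P

/-- The logarithmic factor hidden by the `Õ`:
`√(1 + log T / d) · √(1 + log (1 + r² ‖S₀‖ T / (d σ²)))`, with `‖S₀‖` the operator norm. -/
def logFactor (d T : ℕ) (σ r : ℝ) (S₀ : Matrix (Fin d) (Fin d) ℝ) : ℝ :=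
  √(1 + Real.log T / d) *
    √(1 + Real.log (1 + r ^ 2 * ‖Matrix.toEuclideanCLM (𝕜 := ℝ) S₀‖ * T / (d * σ ^ 2)))

end LinearGaussianBandit

end

/-! Whiten the parameter: with D = √S₀ write θ = Dξ, where ξ is standard Gaussian. After division by
σ, an action a observes ξ with unit noise in the direction b = σ⁻¹Da, so given the history ξ should
be Gaussian with precision V_t = 1 + ∑_{i<t} b_i b_iᵀ. Since θ̂_t and θ have the same law, the
expected regret at time t is E[(θ̂_t - θ)ᵀA_t]. Passing through the posterior mean, Cauchy–Schwarz
for V_t bounds the integrand by σ(s/2 · q_t + x_t/s) for every s > 0, where x_t = b_tᵀV_t⁻¹b_t is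
the leverage and q_t is the sum of the squared V_t-distances of the two parameters from the
posterior mean.

Each of these distances is χ² with d degrees of freedom. Only the moment E exp(·/4) = 2^{d/2} is
needed. It comes from an explicit joint density (`exists_lintegral_history`,
`exists_jointDensity_eq`) for θ, and from probability matching for θ̂_t.

Leverages are controlled along each path. The elliptical potential lemma gives ∑ min(x_t, 1) ≤ M,
with M of order d log(1 + …); in particular at most M rounds have x_t > 1. Those rounds satisfy ∑
x_t ≤ 2r² tr(S₀)/σ², because each removes a definite share of the trace of the posterior covariance
(`sum_large_leverage_le`).

Rounds with x_t ≤ 1 get a weight s = l, and cost T deviations of order d against M: this is the term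
σd√T. Rounds with x_t > 1 get a weight s = m, and cost M deviations against the trace: this is the
term dr√tr(S₀). Which rounds are large is random, so their deviations are truncated at a level of
order d + log T, whence the factor 1 + log T/d. Optimising l and m finishes the proof. -/

namespace LinearGaussianBandit

open Matrix
open scoped ENNReal MatrixOrder

/-! ### Rank-one updates of positive definite matrices. -/

section RankOne

variable {d : ℕ} {V : Matrix (Fin d) (Fin d) ℝ}

lemma isHermitian_dotProduct_mulVec (hV : V.IsHermitian) (u v : Fin d → ℝ) :
    u ⬝ᵥ V *ᵥ v = (V *ᵥ u) ⬝ᵥ v := by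
  have h : Vᵀ = V := by simpa [Matrix.IsHermitian] using hV
  rw [dotProduct_mulVec, ← mulVec_transpose, h]

lemma mulVec_vecMulVec_self (b u : Fin d → ℝ) : vecMulVec b b *ᵥ u = (b ⬝ᵥ u) • b := by
  ext i
  simp [mulVec, vecMulVec_apply, dotProduct, Finset.mul_sum, mul_comm, mul_left_comm]

lemma posSemidef_vecMulVec_self (b : Fin d → ℝ) : (vecMulVec b b).PosSemidef := by
  simpa using Matrix.posSemidef_vecMulVec_self_star b

lemma posDef_dotProduct_inv_nonneg (hV : V.PosDef) (b : Fin d → ℝ) : 0 ≤ b ⬝ᵥ V⁻¹ *ᵥ b := by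
  simpa using hV.inv.posSemidef.dotProduct_mulVec_nonneg b

lemma posDef_mulVec_inv_mulVec (hV : V.PosDef) (b : Fin d → ℝ) : V *ᵥ (V⁻¹ *ᵥ b) = b := by
  rw [mulVec_mulVec, mul_nonsing_inv _ ((isUnit_iff_isUnit_det _).1 hV.isUnit), one_mulVec]

lemma posDef_inv_mulVec_mulVec (hV : V.PosDef) (b : Fin d → ℝ) : V⁻¹ *ᵥ (V *ᵥ b) = b := by
  rw [mulVec_mulVec, nonsing_inv_mul _ ((isUnit_iff_isUnit_det _).1 hV.isUnit), one_mulVec]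

/-- The Cauchy–Schwarz inequality between the norm of `V` and its dual norm, in additive form. -/
lemma dotProduct_le_of_posDef (hV : V.PosDef) (u b : Fin d → ℝ) {l : ℝ} (hl : 0 < l) :
    u ⬝ᵥ b ≤ l / 2 * (u ⬝ᵥ V *ᵥ u) + b ⬝ᵥ V⁻¹ *ᵥ b / (2 * l) := by
  -- Complete the square: the difference of the two sides is the V-norm squared of this vector,
  -- divided by 2l.
  have h := hV.posSemidef.dotProduct_mulVec_nonneg (l • u - V⁻¹ *ᵥ b)
  have h1 : (V⁻¹ *ᵥ b) ⬝ᵥ V *ᵥ u = b ⬝ᵥ u := by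
    rw [isHermitian_dotProduct_mulVec hV.isHermitian, posDef_mulVec_inv_mulVec hV]
  simp only [star_trivial, mulVec_sub, mulVec_smul, posDef_mulVec_inv_mulVec hV, dotProduct_sub,
    sub_dotProduct, smul_dotProduct, dotProduct_smul, smul_eq_mul, h1] at h
  rw [dotProduct_comm (V⁻¹ *ᵥ b) b, dotProduct_comm b u] at h
  have : l / 2 * (u ⬝ᵥ V *ᵥ u) + b ⬝ᵥ V⁻¹ *ᵥ b / (2 * l) - u ⬝ᵥ b =
      (l * (l * u ⬝ᵥ V *ᵥ u) - l * u ⬝ᵥ b - (l * u ⬝ᵥ b - b ⬝ᵥ V⁻¹ *ᵥ b)) / (2 * l) := by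
    field_simp; ring
  have h2 : 0 ≤ l / 2 * (u ⬝ᵥ V *ᵥ u) + b ⬝ᵥ V⁻¹ *ᵥ b / (2 * l) - u ⬝ᵥ b := by
    rw [this]; exact div_nonneg (by linarith) (by linarith)
  linarith

lemma det_add_vecMulVec_self (hV : V.PosDef) (b : Fin d → ℝ) :
    (V + vecMulVec b b).det = V.det * (1 + b ⬝ᵥ V⁻¹ *ᵥ b) := by
  have := det_add_replicateCol_mul_replicateRow (ι := Unit)
    ((isUnit_iff_isUnit_det _).1 hV.isUnit) b b
  rw [← vecMulVec_eq] at this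
  rw [this]
  congr 1
  simp only [det_unique, ← replicateCol_mulVec, replicateCol_apply, Matrix.add_apply,
    one_apply_eq]
  rw [← mulVec_mulVec]
  simp [mulVec, dotProduct]

/-- The Sherman–Morrison formula for a symmetric update. -/
lemma inv_add_vecMulVec_self (hV : V.PosDef) (b : Fin d → ℝ) :
    (V + vecMulVec b b)⁻¹ =
      V⁻¹ - (1 + b ⬝ᵥ V⁻¹ *ᵥ b)⁻¹ • vecMulVec (V⁻¹ *ᵥ b) (V⁻¹ *ᵥ b) := by
  have hx := posDef_dotProduct_inv_nonneg hV b
  have hW : (V + vecMulVec b b).PosDef := hV.add_posSemidef (posSemidef_vecMulVec_self b)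
  apply inv_eq_right_inv
  apply mulVec_injective
  ext1 u
  have h1 : (V⁻¹ *ᵥ b) ⬝ᵥ u = b ⬝ᵥ V⁻¹ *ᵥ u :=
    (isHermitian_dotProduct_mulVec hV.inv.isHermitian b u).symm
  rw [← mulVec_mulVec]
  simp only [sub_mulVec, smul_mulVec, mulVec_vecMulVec_self, add_mulVec, mulVec_sub, mulVec_smul,
    posDef_mulVec_inv_mulVec hV, one_mulVec, h1]
  ext i
  simp only [Pi.add_apply, Pi.sub_apply, Pi.smul_apply, smul_eq_mul]
  field_simp
  ring

end RankOne

section AMGM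

/-- AM–GM for the eigenvalues, in the form of Jensen's inequality for the logarithm. -/
lemma log_det_le {d : ℕ} (hd : 1 ≤ d) {V : Matrix (Fin d) (Fin d) ℝ} (hV : V.PosDef) :
    Real.log V.det ≤ d * Real.log (V.trace / d) := by
  have hd' : (0 : ℝ) < d := by exact_mod_cast hd
  rw [hV.isHermitian.det_eq_prod_eigenvalues, hV.isHermitian.trace_eq_sum_eigenvalues]
  simp only [RCLike.ofReal_real_eq_id, id]
  rw [Real.log_prod (fun i _ => (hV.eigenvalues_pos i).ne')]
  have := strictConcaveOn_log_Ioi.concaveOn.le_map_sum (t := Finset.univ)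
    (w := fun _ : Fin d => (d : ℝ)⁻¹) (p := hV.isHermitian.eigenvalues)
    (fun _ _ => by positivity) (by simp [hd'.ne']) (fun i _ => hV.eigenvalues_pos i)
  simp only [smul_eq_mul, ← Finset.mul_sum] at this
  rw [div_eq_inv_mul]
  calc _ = d * ((d : ℝ)⁻¹ * ∑ i, Real.log (hV.isHermitian.eigenvalues i)) := by
        field_simp
    _ ≤ _ := by gcongr

end AMGM

/-! ### Leverages along a path: elliptical potential and decrease of the trace. -/

section Potential

/-- The posterior precision matrix `1 + ∑ i, bᵢ bᵢᵀ` of a standard Gaussian vector after unit-noise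
observations of it in the directions `b i`. -/
noncomputable def precision {d t : ℕ} (b : Fin t → Fin d → ℝ) : Matrix (Fin d) (Fin d) ℝ :=
  1 + ∑ i, vecMulVec (b i) (b i)

/-- The posterior variance in the direction `b t` after observations in the directions `b i`,
`i < t`. -/
noncomputable def leverage {d : ℕ} (b : ℕ → Fin d → ℝ) (t : ℕ) : ℝ :=
  b t ⬝ᵥ (precision fun i : Fin t => b i)⁻¹ *ᵥ b t

variable {d : ℕ}

lemma precision_posDef {t : ℕ} (b : Fin t → Fin d → ℝ) : (precision b).PosDef :=
  PosDef.one.add_posSemidef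
    (Matrix.posSemidef_sum _ fun i _ => posSemidef_vecMulVec_self (b i))

lemma precision_zero (b : ℕ → Fin d → ℝ) : (precision fun i : Fin 0 => b i) = 1 := by
  simp [precision]

lemma precision_succ (b : ℕ → Fin d → ℝ) (t : ℕ) :
    (precision fun i : Fin (t + 1) => b i) =
      (precision fun i : Fin t => b i) + vecMulVec (b t) (b t) := by
  simp [precision, Fin.sum_univ_castSucc, add_assoc]

lemma dotProduct_precision_mulVec {t : ℕ} (b : Fin t → Fin d → ℝ) (u v : Fin d → ℝ) :
    u ⬝ᵥ precision b *ᵥ v = u ⬝ᵥ v + ∑ i, (b i ⬝ᵥ u) * (b i ⬝ᵥ v) := by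
  simp only [precision, add_mulVec, one_mulVec, dotProduct_add, sum_mulVec, dotProduct_sum,
    mulVec_vecMulVec_self, dotProduct_smul, smul_eq_mul]
  congr 1
  refine Finset.sum_congr rfl fun i _ => ?_
  rw [dotProduct_comm u, mul_comm]

lemma trace_precision {t : ℕ} (b : Fin t → Fin d → ℝ) :
    (precision b).trace = d + ∑ i, b i ⬝ᵥ b i := by
  simp [precision, trace_sum, trace_vecMulVec]

lemma leverage_nonneg (b : ℕ → Fin d → ℝ) (t : ℕ) : 0 ≤ leverage b t :=
  posDef_dotProduct_inv_nonneg (precision_posDef _) _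

/-- By the matrix determinant lemma, 1 + leverage is the ratio of consecutive determinants, so the
sum telescopes. -/
lemma sum_log_leverage (b : ℕ → Fin d → ℝ) (T : ℕ) :
    ∑ t ∈ Finset.range T, Real.log (1 + leverage b t) =
      Real.log (precision fun i : Fin T => b i).det := by
  induction T with
  | zero => simp [precision_zero]
  | succ T ih =>
    rw [Finset.sum_range_succ, ih, precision_succ, det_add_vecMulVec_self (precision_posDef _),
      Real.log_mul (precision_posDef _).det_pos.ne'
        (by have := leverage_nonneg b T; unfold leverage at this; positivity)]
    rfl

/-- The elliptical potential lemma. -/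
lemma sum_log_leverage_le (hd : 1 ≤ d) (b : ℕ → Fin d → ℝ) (T : ℕ) {c : ℝ}
    (hc : ∀ t, b t ⬝ᵥ b t ≤ c) :
    ∑ t ∈ Finset.range T, Real.log (1 + leverage b t) ≤ d * Real.log (1 + c * T / d) := by
  have hd' : (0 : ℝ) < d := by exact_mod_cast hd
  rw [sum_log_leverage]
  refine (log_det_le hd (precision_posDef _)).trans ?_
  have h0 : 0 ≤ ∑ i : Fin T, b i ⬝ᵥ b i :=
    Finset.sum_nonneg fun i _ => by simpa using dotProduct_star_self_nonneg (b i)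
  have h1 : ∑ i : Fin T, b i ⬝ᵥ b i ≤ c * T := by
    refine (Finset.sum_le_sum fun (i : Fin T) _ => hc i).trans ?_
    simp [mul_comm]
  rw [trace_precision, add_div, div_self hd'.ne']
  gcongr

lemma min_one_le_two_mul_log {x : ℝ} (hx : 0 ≤ x) : min x 1 ≤ 2 * Real.log (1 + x) := by
  have h := Real.one_sub_inv_le_log_of_pos (show 0 < 1 + x by linarith)
  have h1 : 1 - (1 + x)⁻¹ = x / (1 + x) := by field_simp; ring
  refine le_trans ?_ (mul_le_mul_of_nonneg_left (h1 ▸ h) zero_le_two)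
  rw [← mul_div_assoc, le_div_iff₀ (by linarith)]
  rcases le_total x 1 with h2 | h2
  · rw [min_eq_left h2]; nlinarith
  · rw [min_eq_right h2]; linarith

lemma sum_min_leverage_le (hd : 1 ≤ d) (b : ℕ → Fin d → ℝ) (T : ℕ) {c : ℝ}
    (hc : ∀ t, b t ⬝ᵥ b t ≤ c) :
    ∑ t ∈ Finset.range T, min (leverage b t) 1 ≤ 2 * (d * Real.log (1 + c * T / d)) := by
  refine le_trans ?_ (mul_le_mul_of_nonneg_left (sum_log_leverage_le hd b T hc) zero_le_two)
  rw [Finset.mul_sum]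
  exact Finset.sum_le_sum fun t _ => min_one_le_two_mul_log (leverage_nonneg b t)

lemma dotProduct_sq_le (u v : Fin d → ℝ) : (u ⬝ᵥ v) ^ 2 ≤ (u ⬝ᵥ u) * (v ⬝ᵥ v) := by
  simpa [dotProduct, sq] using Finset.sum_mul_sq_le_sq_mul_sq Finset.univ u v

/-- Sherman–Morrison makes the loss of trace explicit; this loss pays for the rounds of large
leverage. -/
lemma trace_conj_precision_succ {D : Matrix (Fin d) (Fin d) ℝ} (hD : D.IsHermitian)
    (b : ℕ → Fin d → ℝ) (t : ℕ) :
    (D * (precision fun i : Fin (t + 1) => b i)⁻¹ * D).trace =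
      (D * (precision fun i : Fin t => b i)⁻¹ * D).trace - (1 + leverage b t)⁻¹ *
        ((D *ᵥ ((precision fun i : Fin t => b i)⁻¹ *ᵥ b t)) ⬝ᵥ
          (D *ᵥ ((precision fun i : Fin t => b i)⁻¹ *ᵥ b t))) := by
  have hDt : Dᵀ = D := by simpa [Matrix.IsHermitian] using hD
  rw [precision_succ, inv_add_vecMulVec_self (precision_posDef _), mul_sub, sub_mul, trace_sub]
  congr 1
  rw [Matrix.mul_smul, Matrix.smul_mul, trace_smul, smul_eq_mul, mul_vecMulVec, vecMulVec_mul, trace_vecMulVec,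
    ← mulVec_transpose, hDt]
  rfl

/-- Observations in directions of large posterior variance have a bounded total variance, as each
of them reduces the trace of the covariance matrix. -/
lemma sum_large_leverage_le {D : Matrix (Fin d) (Fin d) ℝ} (hD : D.IsHermitian)
    {a b : ℕ → Fin d → ℝ} (hb : ∀ t, b t = D *ᵥ a t) {r : ℝ} (ha : ∀ t, a t ⬝ᵥ a t ≤ r ^ 2)
    (T : ℕ) :
    ∑ t ∈ Finset.range T, (if 1 < leverage b t then leverage b t else 0) ≤
      2 * r ^ 2 * (D * D).trace := by
  have hDt : Dᴴ = D := hD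
  -- The remaining trace is kept on the left as a potential, so that the induction closes; being
  -- nonnegative, it is dropped at the end.
  have key : ∑ t ∈ Finset.range T, (if 1 < leverage b t then leverage b t else 0) +
      2 * r ^ 2 * (D * (precision fun i : Fin T => b i)⁻¹ * D).trace ≤
        2 * r ^ 2 * (D * D).trace := by
    induction T with
    | zero => simp [precision_zero]
    | succ T ih =>
      refine le_trans ?_ ih
      rw [Finset.sum_range_succ, trace_conj_precision_succ hD]
      set x := leverage b T with hx
      have hx0 : 0 ≤ x := leverage_nonneg b T
      set v := (precision fun i : Fin T => b i)⁻¹ *ᵥ b T with hv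
      have hxa : x = a T ⬝ᵥ D *ᵥ v := by
        rw [isHermitian_dotProduct_mulVec hD, ← hb]
        rfl
      have hvv : 0 ≤ (D *ᵥ v) ⬝ᵥ (D *ᵥ v) := by simpa using dotProduct_star_self_nonneg (D *ᵥ v)
      have h1 : x ^ 2 ≤ r ^ 2 * ((D *ᵥ v) ⬝ᵥ (D *ᵥ v)) := by
        rw [hxa]
        exact (dotProduct_sq_le _ _).trans (mul_le_mul_of_nonneg_right (ha T) hvv)
      -- For x > 1 one has x ≤ 2x²/(1 + x), and x² is bounded by r²‖Dv‖² because x = aᵀDv.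
      have h2 : (if 1 < x then x else 0) ≤
          2 * ((1 + x)⁻¹ * (r ^ 2 * ((D *ᵥ v) ⬝ᵥ (D *ᵥ v)))) := by
        split_ifs with hx1
        · refine le_trans ?_ (mul_le_mul_of_nonneg_left (mul_le_mul_of_nonneg_left h1
            (inv_nonneg.2 (by linarith))) zero_le_two)
          rw [← div_eq_inv_mul, ← mul_div_assoc, le_div_iff₀ (by linarith)]
          nlinarith
        · positivity
      linarith
  have h0 : 0 ≤ (D * (precision fun i : Fin T => b i)⁻¹ * D).trace := by
    have := (precision_posDef fun i : Fin T => b i).inv.posSemidef.mul_mul_conjTranspose_same D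
    rw [hDt] at this
    exact this.trace_nonneg
  nlinarith [mul_nonneg (sq_nonneg r) h0]

end Potential

/-! ### Joint law of the parameter and the history. -/

lemma pi_gaussianReal_eq_withDensity (d : ℕ) :
    Measure.pi (fun _ : Fin d => gaussianReal 0 1) =
      (volume : Measure (Fin d → ℝ)).withDensity fun x => ∏ i, gaussianPDF 0 1 (x i) := by
  refine Measure.pi_eq fun s hs => ?_
  rw [withDensity_apply _ (MeasurableSet.univ_pi hs), volume_pi, Measure.restrict_pi_pi]
  have h1 : ∀ x : Fin d → ℝ, ∏ i, gaussianPDF 0 1 (x i) =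
      ENNReal.ofReal (∏ i, gaussianPDFReal 0 1 (x i)) := fun x =>
    (ENNReal.ofReal_prod_of_nonneg fun i _ => gaussianPDFReal_nonneg _ _ _).symm
  have h2 : ∀ i, Integrable (gaussianPDFReal 0 1) (volume.restrict (s i)) := fun i =>
    (integrable_gaussianPDFReal 0 1).restrict
  simp_rw [h1]
  rw [← ofReal_integral_eq_lintegral_ofReal (Integrable.fintype_prod h2)
    (ae_of_all _ fun x => Finset.prod_nonneg fun i _ => gaussianPDFReal_nonneg _ _ _),
    integral_fintype_prod_eq_prod, ENNReal.ofReal_prod_of_nonneg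
      fun i _ => integral_nonneg fun x => gaussianPDFReal_nonneg _ _ _]
  refine Finset.prod_congr rfl fun i _ => ?_
  rw [gaussianReal_apply_eq_integral _ one_ne_zero]

lemma lintegral_map_compProd_prod {α β γ δ : Type*} [MeasurableSpace α] [MeasurableSpace β]
    [MeasurableSpace γ] [MeasurableSpace δ] {ν : Measure α} [SFinite ν] {κ : Kernel α β}
    [IsSFiniteKernel κ] {ρ : Measure γ} [SFinite ρ] {Φ : (α × β) × γ → δ} (hΦ : Measurable Φ)
    {g : δ → ℝ≥0∞} (hg : Measurable g) :
    ∫⁻ x, g x ∂(((ν ⊗ₘ κ).prod ρ).map Φ) =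
      ∫⁻ a, (∫⁻ b, (∫⁻ c, g (Φ ((a, b), c)) ∂ρ) ∂(κ a)) ∂ν := by
  have h : Measurable fun x => g (Φ x) := hg.comp hΦ
  rw [lintegral_map hg hΦ, lintegral_prod _ h.aemeasurable]
  exact Measure.lintegral_compProd h.lintegral_prod_right'

lemma measurable_toLp_mulVec {d : ℕ} (D : Matrix (Fin d) (Fin d) ℝ) :
    Measurable fun ξ : Fin d → ℝ => WithLp.toLp 2 (D *ᵥ ξ) :=
  (by fun_prop : Measurable (WithLp.toLp 2 : (Fin d → ℝ) → _)).comp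
    (Continuous.matrix_mulVec continuous_const continuous_id).measurable

lemma lintegral_multivariateGaussian {d : ℕ} (S : Matrix (Fin d) (Fin d) ℝ)
    {f : EuclideanSpace ℝ (Fin d) → ℝ≥0∞} (hf : Measurable f) :
    ∫⁻ x, f x ∂(multivariateGaussian 0 S) =
      ∫⁻ ξ, f (WithLp.toLp 2 (CFC.sqrt S *ᵥ ξ)) * ∏ i, gaussianPDF 0 1 (ξ i) := by
  have hm : Measurable fun ξ : Fin d → ℝ => ∏ i, gaussianPDF 0 1 (ξ i) :=
    Finset.measurable_prod _ fun i _ =>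
      (measurable_gaussianPDF 0 1).comp (measurable_pi_apply i)
  have hf' := hf.comp (measurable_toLp_mulVec (CFC.sqrt S))
  rw [multivariateGaussian, ← map_pi_eq_stdGaussian, Measure.map_map (by fun_prop) (by fun_prop),
    lintegral_map hf (by fun_prop), pi_gaussianReal_eq_withDensity,
    lintegral_withDensity_eq_lintegral_mul _ hm]
  · refine lintegral_congr fun ξ => ?_
    simp [mul_comm]
  · simpa [Function.comp_def] using hf'

/-- Translation invariance of Lebesgue measure: the noise w is traded for the reward y = m + w, so
that the mean m enters through the density alone. -/
lemma lintegral_gaussianReal_zero {v : NNReal} (hv : v ≠ 0) {f : ℝ → ℝ≥0∞} (hf : Measurable f)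
    (m : ℝ) :
    ∫⁻ w, f (m + w) ∂(gaussianReal 0 v) = ∫⁻ y, f y * gaussianPDF 0 v (y - m) := by
  rw [gaussianReal_of_var_ne_zero _ hv, lintegral_withDensity_eq_lintegral_mul _
    (measurable_gaussianPDF 0 v) (by fun_prop),
    ← lintegral_add_left_eq_self (fun y => f y * gaussianPDF 0 v (y - m)) m]
  refine lintegral_congr fun w => ?_
  simp [mul_comm]

/-- The joint density of the whitened parameter and the history, with respect to Lebesgue measure
in the parameter and in the rewards, up to the factors that do not depend on the parameter. -/
noncomputable def jointDensity {d : ℕ} (D : Matrix (Fin d) (Fin d) ℝ) (σ : ℝ) {t : ℕ}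
    (ξ : Fin d → ℝ) (h : Fin t → EuclideanSpace ℝ (Fin d) × ℝ) : ℝ≥0∞ :=
  (∏ i, gaussianPDF 0 1 (ξ i)) *
    ∏ i, gaussianPDF 0 (σ ^ 2).toNNReal ((h i).2 - inner ℝ (WithLp.toLp 2 (D *ᵥ ξ)) (h i).1)

lemma measurable_jointDensity {d : ℕ} (D : Matrix (Fin d) (Fin d) ℝ) (σ : ℝ) (t : ℕ) :
    Measurable fun p : (Fin d → ℝ) × (Fin t → EuclideanSpace ℝ (Fin d) × ℝ) =>
      jointDensity D σ p.1 p.2 := by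
  unfold jointDensity
  refine Measurable.mul ?_ ?_
  · exact Finset.measurable_prod _ fun i _ => (measurable_gaussianPDF 0 1).comp (by fun_prop)
  · refine Finset.measurable_prod _ fun i _ => (measurable_gaussianPDF 0 _).comp ?_
    have := (measurable_toLp_mulVec D).comp
      (measurable_fst : Measurable
        (Prod.fst : (Fin d → ℝ) × (Fin t → EuclideanSpace ℝ (Fin d) × ℝ) → _))
    refine Measurable.sub (by fun_prop) (Measurable.inner this (by fun_prop))

lemma measurable_jointDensity_right {d : ℕ} (D : Matrix (Fin d) (Fin d) ℝ) (σ : ℝ) (t : ℕ)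
    (ξ : Fin d → ℝ) :
    Measurable fun h : Fin t → EuclideanSpace ℝ (Fin d) × ℝ => jointDensity D σ ξ h := by
  unfold jointDensity
  refine Measurable.const_mul (Finset.measurable_prod _ fun i _ =>
    (measurable_gaussianPDF 0 _).comp ?_) _
  exact Measurable.sub (by fun_prop) (Measurable.inner measurable_const (by fun_prop))

lemma measurable_snoc {α : Type*} [MeasurableSpace α] (t : ℕ) :
    Measurable fun p : (Fin t → α) × α => (Fin.snoc p.1 p.2 : Fin (t + 1) → α) := by
  refine measurable_pi_lambda _ fun i => ?_
  refine Fin.lastCases ?_ (fun i => ?_) i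
  · simpa using measurable_snd
  · simp only [Fin.snoc_castSucc]; fun_prop

lemma jointDensity_snoc {d : ℕ} (D : Matrix (Fin d) (Fin d) ℝ) (σ : ℝ) {t : ℕ}
    (ξ : Fin d → ℝ) (h : Fin t → EuclideanSpace ℝ (Fin d) × ℝ)
    (a : EuclideanSpace ℝ (Fin d)) (y : ℝ) :
    jointDensity D σ ξ (Fin.snoc h (a, y) : Fin (t + 1) → EuclideanSpace ℝ (Fin d) × ℝ) =
      jointDensity D σ ξ h *
        gaussianPDF 0 (σ ^ 2).toNNReal (y - inner ℝ (WithLp.toLp 2 (D *ᵥ ξ)) a) := by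
  simp [jointDensity, Fin.prod_univ_castSucc, mul_assoc]

section History

variable {d : ℕ} {Ω : Type*} (θ : Ω → EuclideanSpace ℝ (Fin d))
  (A : ℕ → Ω → EuclideanSpace ℝ (Fin d)) (W : ℕ → Ω → ℝ)

lemma history_succ (t : ℕ) (ω : Ω) :
    history θ A W (t + 1) ω =
      Fin.snoc (history θ A W t ω) (A t ω, inner ℝ (θ ω) (A t ω) + W (t + 1) ω) := by
  ext1 i
  refine Fin.lastCases ?_ (fun i => ?_) i
  · simp [history, rewardAfter]
  · simp [history]

lemma measurable_history [MeasurableSpace Ω] {θ : Ω → EuclideanSpace ℝ (Fin d)}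
    {A : ℕ → Ω → EuclideanSpace ℝ (Fin d)} {W : ℕ → Ω → ℝ} (hθ : Measurable θ)
    (hA : ∀ t, Measurable (A t)) (hW : ∀ t, Measurable (W (t + 1))) (t : ℕ) :
    Measurable (history θ A W t) := by
  refine measurable_pi_lambda _ fun i => ?_
  have := hA i
  have := hW i
  unfold history rewardAfter
  fun_prop

end History

/-- The expectation of `f` at the parameter `p.1` and the history that extends `p.2` by one action,
drawn by means of the kernel `κ`, and its reward. -/
noncomputable def stepIntegral {d t : ℕ}
    (aStar : EuclideanSpace ℝ (Fin d) → EuclideanSpace ℝ (Fin d)) (σ : ℝ)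
    (κ : Kernel (Fin t → EuclideanSpace ℝ (Fin d) × ℝ) (EuclideanSpace ℝ (Fin d)))
    (f : EuclideanSpace ℝ (Fin d) × (Fin (t + 1) → EuclideanSpace ℝ (Fin d) × ℝ) → ℝ≥0∞)
    (p : EuclideanSpace ℝ (Fin d) × (Fin t → EuclideanSpace ℝ (Fin d) × ℝ)) : ℝ≥0∞ :=
  ∫⁻ z, (∫⁻ y : ℝ, f (p.1, Fin.snoc p.2 (aStar z, y)) *
    gaussianPDF 0 (σ ^ 2).toNNReal (y - inner ℝ p.1 (aStar z))) ∂(κ p.2)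

lemma measurable_stepIntegrand {d t : ℕ}
    {aStar : EuclideanSpace ℝ (Fin d) → EuclideanSpace ℝ (Fin d)} (ha : Measurable aStar) (σ : ℝ)
    {f : EuclideanSpace ℝ (Fin d) × (Fin (t + 1) → EuclideanSpace ℝ (Fin d) × ℝ) → ℝ≥0∞}
    (hf : Measurable f) :
    Measurable fun q : ((EuclideanSpace ℝ (Fin d) × (Fin t → EuclideanSpace ℝ (Fin d) × ℝ)) ×
        EuclideanSpace ℝ (Fin d)) × ℝ =>
      f (q.1.1.1, Fin.snoc q.1.1.2 (aStar q.1.2, q.2)) *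
        gaussianPDF 0 (σ ^ 2).toNNReal (q.2 - inner ℝ q.1.1.1 (aStar q.1.2)) := by
  refine Measurable.mul ?_ ((measurable_gaussianPDF 0 _).comp
    (Measurable.sub (by fun_prop) (Measurable.inner (by fun_prop) (by fun_prop))))
  exact hf.comp (Measurable.prodMk (by fun_prop) ((measurable_snoc t).comp
    (Measurable.prodMk (by fun_prop) (Measurable.prodMk (by fun_prop) (by fun_prop)))))

lemma measurable_stepIntegral {d t : ℕ}
    {aStar : EuclideanSpace ℝ (Fin d) → EuclideanSpace ℝ (Fin d)} (ha : Measurable aStar) (σ : ℝ)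
    (κ : Kernel (Fin t → EuclideanSpace ℝ (Fin d) × ℝ) (EuclideanSpace ℝ (Fin d)))
    [IsSFiniteKernel κ]
    {f : EuclideanSpace ℝ (Fin d) × (Fin (t + 1) → EuclideanSpace ℝ (Fin d) × ℝ) → ℝ≥0∞}
    (hf : Measurable f) : Measurable (stepIntegral aStar σ κ f) :=
  Measurable.lintegral_kernel_prod_right'
    (κ := Kernel.prodMkLeft (EuclideanSpace ℝ (Fin d)) κ)
    (measurable_stepIntegrand ha σ hf).lintegral_prod_right'

lemma stepIntegral_mul_const {d t : ℕ}
    {aStar : EuclideanSpace ℝ (Fin d) → EuclideanSpace ℝ (Fin d)} (ha : Measurable aStar) (σ : ℝ)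
    (κ : Kernel (Fin t → EuclideanSpace ℝ (Fin d) × ℝ) (EuclideanSpace ℝ (Fin d)))
    {f : EuclideanSpace ℝ (Fin d) × (Fin (t + 1) → EuclideanSpace ℝ (Fin d) × ℝ) → ℝ≥0∞}
    (hf : Measurable f) (p : EuclideanSpace ℝ (Fin d) × (Fin t → EuclideanSpace ℝ (Fin d) × ℝ))
    (c : ℝ≥0∞) :
    stepIntegral aStar σ κ f p * c = ∫⁻ z, (∫⁻ y : ℝ, f (p.1, Fin.snoc p.2 (aStar z, y)) *
      gaussianPDF 0 (σ ^ 2).toNNReal (y - inner ℝ p.1 (aStar z)) * c) ∂(κ p.2) := by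
  have hs : Measurable fun q : EuclideanSpace ℝ (Fin d) × ℝ =>
      f (p.1, Fin.snoc p.2 (aStar q.1, q.2)) *
        gaussianPDF 0 (σ ^ 2).toNNReal (q.2 - inner ℝ p.1 (aStar q.1)) := by
    have h1 : Measurable fun q : EuclideanSpace ℝ (Fin d) × ℝ => ((p, q.1), q.2) := by fun_prop
    exact (measurable_stepIntegrand ha σ hf).comp h1
  rw [stepIntegral, ← lintegral_mul_const _ hs.lintegral_prod_right']
  refine lintegral_congr fun z => ?_
  have hz : Measurable fun y : ℝ => (z, y) := by fun_prop
  exact (lintegral_mul_const _ (hs.comp hz)).symm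

section Posterior

variable {d : ℕ} {Ω : Type*} [MeasurableSpace Ω] {S₀ : Matrix (Fin d) (Fin d) ℝ} {σ : ℝ}
  {aStar : EuclideanSpace ℝ (Fin d) → EuclideanSpace ℝ (Fin d)} {P : Measure Ω}
  [IsProbabilityMeasure P] {θ : Ω → EuclideanSpace ℝ (Fin d)} {W : ℕ → Ω → ℝ}
  {θhat : ℕ → Ω → EuclideanSpace ℝ (Fin d)}

namespace IsThompsonSampling

lemma measurable_action (hTS : IsThompsonSampling S₀ σ aStar P θ W θhat) (ha : Measurable aStar)
    (t : ℕ) : Measurable (thompsonAction aStar θhat t) :=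
  ha.comp (hTS.measurable_sample t)

lemma measurable_history (hTS : IsThompsonSampling S₀ σ aStar P θ W θhat) (ha : Measurable aStar)
    (t : ℕ) : Measurable (history θ (thompsonAction aStar θhat) W t) :=
  LinearGaussianBandit.measurable_history hTS.measurable_param (hTS.measurable_action ha)
    hTS.measurable_noise t

/-- Probability matching: given the history, the sample is distributed as the parameter. -/
lemma map_sample_eq (hTS : IsThompsonSampling S₀ σ aStar P θ W θhat) (ha : Measurable aStar)
    (t : ℕ) :
    P.map (fun ω => (history θ (thompsonAction aStar θhat) W t ω, θhat t ω)) =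
      P.map (fun ω => (history θ (thompsonAction aStar θhat) W t ω, θ ω)) := by
  have hH := hTS.measurable_history ha t
  have hθ := hTS.measurable_param
  have h := (hTS.posterior_sample t)
  have h2 : HasCondDistrib (θhat t)
      (fun ω => history θ (thompsonAction aStar θhat) W t ω)
      (condDistrib θ (history θ (thompsonAction aStar θhat) W t) P) P :=
    HasCondDistrib.comp_right (hf := measurable_snd) h
  rw [h2.map_eq]
  exact compProd_map_condDistrib hθ.aemeasurable

/-- One round of the bandit: the noise is integrated out by independence, then the sample by its
conditional law. -/
lemma lintegral_history_succ (hTS : IsThompsonSampling S₀ σ aStar P θ W θhat)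
    (ha : Measurable aStar) (hσ : 0 < σ) (t : ℕ)
    {f : EuclideanSpace ℝ (Fin d) × (Fin (t + 1) → EuclideanSpace ℝ (Fin d) × ℝ) → ℝ≥0∞}
    (hf : Measurable f) :
    ∫⁻ ω, f (θ ω, history θ (thompsonAction aStar θhat) W (t + 1) ω) ∂P =
      ∫⁻ ω, stepIntegral aStar σ (condDistrib θ (history θ (thompsonAction aStar θhat) W t) P) f
        (θ ω, history θ (thompsonAction aStar θhat) W t ω) ∂P := by
  have hH := hTS.measurable_history ha t
  have hθ := hTS.measurable_param
  have hz := hTS.measurable_sample t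
  have hW := hTS.measurable_noise t
  have hv : (σ ^ 2).toNNReal ≠ 0 := by simpa using hσ.ne'
  have hlaw := (indepFun_iff_map_prod_eq_prod_map_map hW.aemeasurable
    (by fun_prop)).1 (hTS.noise_indep t)
  set H := history θ (thompsonAction aStar θhat) W t with hHdef
  set κ := condDistrib θ H P
  set F : ℝ × ((EuclideanSpace ℝ (Fin d) × (Fin t → EuclideanSpace ℝ (Fin d) × ℝ)) ×
      EuclideanSpace ℝ (Fin d)) → ℝ≥0∞ := fun q =>
    f (q.2.1.1, Fin.snoc q.2.1.2 (aStar q.2.2, inner ℝ q.2.1.1 (aStar q.2.2) + q.1)) with hF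
  have hFm : Measurable F := by
    refine hf.comp (Measurable.prodMk (by fun_prop) ((measurable_snoc t).comp
      (Measurable.prodMk (by fun_prop) (Measurable.prodMk (by fun_prop) ?_))))
    exact (Measurable.inner (by fun_prop) (by fun_prop)).add (by fun_prop)
  have hsn : ∀ (p : EuclideanSpace ℝ (Fin d) × (Fin t → EuclideanSpace ℝ (Fin d) × ℝ))
      (a : EuclideanSpace ℝ (Fin d)), Measurable fun y => f (p.1, Fin.snoc p.2 (a, y)) :=
    fun p a => hf.comp (Measurable.prodMk (by fun_prop) ((measurable_snoc t).comp
      (Measurable.prodMk (by fun_prop) (by fun_prop))))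
  calc ∫⁻ ω, f (θ ω, history θ (thompsonAction aStar θhat) W (t + 1) ω) ∂P
      = ∫⁻ ω, F (W (t + 1) ω, ((θ ω, H ω), θhat t ω)) ∂P := by
        simp_rw [history_succ]
        rfl
    _ = ∫⁻ q, F q ∂((gaussianReal 0 (σ ^ 2).toNNReal).prod
          (P.map fun ω => ((θ ω, H ω), θhat t ω))) := by
        rw [← (hTS.noise t).map_eq, ← hlaw, lintegral_map hFm (by fun_prop)]
    _ = ∫⁻ p, ∫⁻ w, F (w, p) ∂(gaussianReal 0 (σ ^ 2).toNNReal)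
          ∂(P.map fun ω => ((θ ω, H ω), θhat t ω)) := by
        have : IsProbabilityMeasure (P.map fun ω => ((θ ω, H ω), θhat t ω)) :=
          Measure.isProbabilityMeasure_map (by fun_prop)
        rw [lintegral_prod_symm _ hFm.aemeasurable]
    _ = ∫⁻ p, (∫⁻ z, (∫⁻ w, F (w, (p, z)) ∂(gaussianReal 0 (σ ^ 2).toNNReal))
          ∂(κ p.2)) ∂(P.map fun ω => (θ ω, H ω)) := by
        have : IsProbabilityMeasure (P.map fun ω => (θ ω, H ω)) :=
          Measure.isProbabilityMeasure_map (by fun_prop)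
        rw [(hTS.posterior_sample t).map_eq, Measure.lintegral_compProd]
        · simp only [Kernel.prodMkLeft_apply]
          rfl
        · exact hFm.lintegral_prod_left'
    _ = ∫⁻ p, stepIntegral aStar σ κ f p ∂(P.map fun ω => (θ ω, H ω)) := by
        refine lintegral_congr fun p => lintegral_congr fun z => ?_
        rw [← lintegral_gaussianReal_zero hv (hsn p (aStar z))]
    _ = _ := lintegral_map (measurable_stepIntegral ha σ κ hf) (by fun_prop)

/-- Bayes' rule for adaptively chosen actions. The sampling kernel depends on the history alone, so
it can be absorbed into a reference measure `ν` that does not involve ξ; what remains is prior times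
Gaussian likelihood. The measure `ν` is only s-finite, since rewards are integrated against Lebesgue
measure. -/
lemma exists_lintegral_history (hTS : IsThompsonSampling S₀ σ aStar P θ W θhat)
    (ha : Measurable aStar) (hσ : 0 < σ) (t : ℕ) :
    ∃ ν : Measure (Fin t → EuclideanSpace ℝ (Fin d) × ℝ), SFinite ν ∧
      ∀ f : EuclideanSpace ℝ (Fin d) × (Fin t → EuclideanSpace ℝ (Fin d) × ℝ) → ℝ≥0∞,
        Measurable f →
        ∫⁻ ω, f (θ ω, history θ (thompsonAction aStar θhat) W t ω) ∂P =
          ∫⁻ ξ, ∫⁻ h, f (WithLp.toLp 2 (CFC.sqrt S₀ *ᵥ ξ), h) * jointDensity (CFC.sqrt S₀) σ ξ h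
            ∂ν := by
  induction t with
  | zero =>
    refine ⟨Measure.dirac default, inferInstance, fun f hf => ?_⟩
    have hm : Measurable fun x : EuclideanSpace ℝ (Fin d) =>
        f (x, (default : Fin 0 → EuclideanSpace ℝ (Fin d) × ℝ)) := hf.comp (by fun_prop)
    have h0 : ∀ ω, history θ (thompsonAction aStar θhat) W 0 ω = default :=
      fun ω => Subsingleton.elim _ _
    simp_rw [h0]
    rw [← lintegral_map hm hTS.measurable_param, hTS.prior.map_eq,
      lintegral_multivariateGaussian S₀ hm]
    refine lintegral_congr fun ξ => ?_
    rw [lintegral_dirac]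
    simp [jointDensity]
  | succ t ih =>
    obtain ⟨ν, hν, ih⟩ := ih
    set κ := condDistrib θ (history θ (thompsonAction aStar θhat) W t) P
    let Φ : ((Fin t → EuclideanSpace ℝ (Fin d) × ℝ) × EuclideanSpace ℝ (Fin d)) × ℝ →
        (Fin (t + 1) → EuclideanSpace ℝ (Fin d) × ℝ) :=
      fun q => Fin.snoc q.1.1 (aStar q.1.2, q.2)
    have hΦ : Measurable Φ :=
      (measurable_snoc t).comp (Measurable.prodMk (by fun_prop) (by fun_prop))
    -- Append an action drawn through the posterior kernel and a reward under Lebesgue measure.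
    refine ⟨((ν ⊗ₘ κ).prod (volume : Measure ℝ)).map Φ, inferInstance, fun f hf => ?_⟩
    rw [hTS.lintegral_history_succ ha hσ t hf, ih _ (measurable_stepIntegral ha σ κ hf)]
    refine lintegral_congr fun ξ => ?_
    set x := WithLp.toLp 2 (CFC.sqrt S₀ *ᵥ ξ) with hx
    have hg : Measurable fun h : Fin (t + 1) → EuclideanSpace ℝ (Fin d) × ℝ =>
        f (x, h) * jointDensity (CFC.sqrt S₀) σ ξ h :=
      (hf.comp measurable_prodMk_left).mul (measurable_jointDensity_right _ σ _ ξ)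
    rw [lintegral_map_compProd_prod hΦ hg]
    refine lintegral_congr fun h => ?_
    rw [stepIntegral_mul_const ha σ κ hf]
    refine lintegral_congr fun z => lintegral_congr fun y => ?_
    simp only [Φ]
    rw [jointDensity_snoc, ← hx]
    ring

end IsThompsonSampling

end Posterior

/-! ### Gaussian form of the posterior and deviation from its mean. -/

section Deviation

variable {d : ℕ} (D : Matrix (Fin d) (Fin d) ℝ) (σ : ℝ)

/-- The direction in which the whitened parameter is observed, with unit noise, by the action
`a`. -/
noncomputable def direction (a : EuclideanSpace ℝ (Fin d)) : Fin d → ℝ :=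
  σ⁻¹ • (D *ᵥ a.ofLp)

/-- The posterior precision matrix of the whitened parameter. -/
noncomputable def posteriorPrecision {t : ℕ} (h : Fin t → EuclideanSpace ℝ (Fin d) × ℝ) :
    Matrix (Fin d) (Fin d) ℝ :=
  precision fun i => direction D σ (h i).1

/-- The posterior mean of the whitened parameter. -/
noncomputable def posteriorMean {t : ℕ} (h : Fin t → EuclideanSpace ℝ (Fin d) × ℝ) : Fin d → ℝ :=
  (posteriorPrecision D σ h)⁻¹ *ᵥ ∑ i, (σ⁻¹ * (h i).2) • direction D σ (h i).1

/-- The squared distance of `ξ` from the posterior mean, in the norm of the posterior precision. -/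
noncomputable def deviation {t : ℕ} (h : Fin t → EuclideanSpace ℝ (Fin d) × ℝ)
    (ξ : Fin d → ℝ) : ℝ :=
  (ξ - posteriorMean D σ h) ⬝ᵥ posteriorPrecision D σ h *ᵥ (ξ - posteriorMean D σ h)

variable {D σ} {t : ℕ}

lemma posteriorPrecision_posDef (h : Fin t → EuclideanSpace ℝ (Fin d) × ℝ) :
    (posteriorPrecision D σ h).PosDef :=
  precision_posDef _

lemma dotProduct_direction (hD : D.IsHermitian) (ξ : Fin d → ℝ) (a : EuclideanSpace ℝ (Fin d)) :
    ξ ⬝ᵥ direction D σ a = σ⁻¹ * inner ℝ (WithLp.toLp 2 (D *ᵥ ξ)) a := by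
  rw [direction, dotProduct_smul, smul_eq_mul, isHermitian_dotProduct_mulVec hD,
    EuclideanSpace.inner_eq_star_dotProduct, dotProduct_comm]
  simp

/-- Completing the square in the negative log-posterior: the parenthesis on the right is free of ξ.
-/
lemma sq_residuals_eq (hD : D.IsHermitian) (h : Fin t → EuclideanSpace ℝ (Fin d) × ℝ)
    (ξ : Fin d → ℝ) :
    ξ ⬝ᵥ ξ + ∑ i, (σ⁻¹ * ((h i).2 - inner ℝ (WithLp.toLp 2 (D *ᵥ ξ)) (h i).1)) ^ 2 =
      deviation D σ h ξ + (∑ i, (σ⁻¹ * (h i).2) ^ 2 -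
        posteriorMean D σ h ⬝ᵥ posteriorPrecision D σ h *ᵥ posteriorMean D σ h) := by
  set V := posteriorPrecision D σ h with hV
  have hVp : V.PosDef := posteriorPrecision_posDef h
  set μ := posteriorMean D σ h with hμ
  have hVμ : V *ᵥ μ = ∑ i, (σ⁻¹ * (h i).2) • direction D σ (h i).1 :=
    posDef_mulVec_inv_mulVec hVp _
  have h1 : μ ⬝ᵥ V *ᵥ ξ = ∑ i, (σ⁻¹ * (h i).2) * (ξ ⬝ᵥ direction D σ (h i).1) := by
    rw [isHermitian_dotProduct_mulVec hVp.isHermitian, hVμ, dotProduct_comm, dotProduct_sum]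
    simp
  have h2 : ξ ⬝ᵥ V *ᵥ μ = ∑ i, (σ⁻¹ * (h i).2) * (ξ ⬝ᵥ direction D σ (h i).1) := by
    rw [hVμ, dotProduct_sum]
    simp
  have h3 : ξ ⬝ᵥ V *ᵥ ξ = ξ ⬝ᵥ ξ + ∑ i, (ξ ⬝ᵥ direction D σ (h i).1) ^ 2 := by
    rw [hV, posteriorPrecision, dotProduct_precision_mulVec]
    simp [sq, dotProduct_comm ξ]
  have h4 : deviation D σ h ξ = ξ ⬝ᵥ V *ᵥ ξ - ξ ⬝ᵥ V *ᵥ μ - μ ⬝ᵥ V *ᵥ ξ + μ ⬝ᵥ V *ᵥ μ := by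
    rw [deviation, mulVec_sub, dotProduct_sub, sub_dotProduct, sub_dotProduct]
    ring
  have h5 : ∑ i, (σ⁻¹ * ((h i).2 - inner ℝ (WithLp.toLp 2 (D *ᵥ ξ)) (h i).1)) ^ 2 =
      ∑ i, (σ⁻¹ * (h i).2) ^ 2 - 2 * ∑ i, (σ⁻¹ * (h i).2) * (ξ ⬝ᵥ direction D σ (h i).1) +
        ∑ i, (ξ ⬝ᵥ direction D σ (h i).1) ^ 2 := by
    rw [Finset.mul_sum, ← Finset.sum_sub_distrib, ← Finset.sum_add_distrib]
    refine Finset.sum_congr rfl fun i _ => ?_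
    rw [dotProduct_direction hD]
    ring
  rw [h5, h4, h1, h2, h3]
  ring

lemma gaussianPDF_zero_eq {s : ℝ} (hs : 0 < s) (x : ℝ) :
    gaussianPDF 0 (s ^ 2).toNNReal x =
      ENNReal.ofReal ((√(2 * Real.pi * s ^ 2))⁻¹ * Real.exp (-((s⁻¹ * x) ^ 2 / 2))) := by
  rw [gaussianPDF, gaussianPDFReal, Real.coe_toNNReal _ (sq_nonneg s), sub_zero]
  congr 3
  field_simp

/-- Up to a factor that depends only on the history, the joint density is Gaussian in the
parameter. -/
lemma exists_jointDensity_eq (hD : D.IsHermitian) (hσ : 0 < σ)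
    (h : Fin t → EuclideanSpace ℝ (Fin d) × ℝ) :
    ∃ c : ℝ≥0∞, ∀ ξ, jointDensity D σ ξ h =
      c * ENNReal.ofReal (Real.exp (-(deviation D σ h ξ / 2))) := by
  refine ⟨ENNReal.ofReal ((∏ _i : Fin d, (√(2 * Real.pi * 1 ^ 2))⁻¹) *
    (∏ _i : Fin t, (√(2 * Real.pi * σ ^ 2))⁻¹) *
    Real.exp (-((∑ i, (σ⁻¹ * (h i).2) ^ 2 -
        posteriorMean D σ h ⬝ᵥ posteriorPrecision D σ h *ᵥ posteriorMean D σ h) / 2))),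
    fun ξ => ?_⟩
  have h1 : gaussianPDF 0 1 = gaussianPDF 0 ((1 : ℝ) ^ 2).toNNReal := by simp
  rw [jointDensity, h1]
  simp_rw [gaussianPDF_zero_eq hσ, gaussianPDF_zero_eq one_pos]
  rw [← ENNReal.ofReal_prod_of_nonneg fun i _ => by positivity,
    ← ENNReal.ofReal_prod_of_nonneg fun i _ => by positivity, ← ENNReal.ofReal_mul
      (Finset.prod_nonneg fun i _ => by positivity), ← ENNReal.ofReal_mul (by positivity)]
  congr 1
  rw [Finset.prod_mul_distrib, Finset.prod_mul_distrib, ← Real.exp_sum, ← Real.exp_sum,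
    mul_assoc _ (Real.exp _) (Real.exp _), ← Real.exp_add, mul_mul_mul_comm, ← Real.exp_add]
  congr 2
  have h2 := sq_residuals_eq hD h ξ (σ := σ)
  have h3 : ∑ i, (1⁻¹ * ξ i) ^ 2 = ξ ⬝ᵥ ξ := by simp [dotProduct, sq]
  simp only [Finset.sum_neg_distrib, ← Finset.sum_div]
  rw [h3]
  linarith

lemma lintegral_comp_smul_fin (d : ℕ) {c : ℝ} (hc : 0 < c) (g : (Fin d → ℝ) → ℝ≥0∞)
    (hg : Measurable g) :
    ∫⁻ x, g x = ENNReal.ofReal (c ^ d) * ∫⁻ x, g (c • x) := by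
  have h := Measure.map_addHaar_smul (volume : Measure (Fin d → ℝ)) hc.ne'
  rw [← lintegral_map hg (measurable_const_smul c), h, lintegral_smul_measure, smul_eq_mul,
    ← mul_assoc, ← ENNReal.ofReal_mul (by positivity)]
  simp only [Module.finrank_fintype_fun_eq_card, Fintype.card_fin]
  rw [abs_of_pos (by positivity), mul_inv_cancel₀ (by positivity)]
  simp

/-- Translating to the posterior mean and scaling by √2 turns one quadratic form into the other. The
ratio √2^d is the same for all histories. -/
lemma lintegral_exp_deviation (h : Fin t → EuclideanSpace ℝ (Fin d) × ℝ) :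
    ∫⁻ ξ, ENNReal.ofReal (Real.exp (-(deviation D σ h ξ / 4))) =
      ENNReal.ofReal (√2 ^ d) * ∫⁻ ξ, ENNReal.ofReal (Real.exp (-(deviation D σ h ξ / 2))) := by
  set V := posteriorPrecision D σ h with hV
  have key : ∀ s : ℝ, ∫⁻ ξ, ENNReal.ofReal (Real.exp (-(deviation D σ h ξ / s))) =
      ∫⁻ ξ, ENNReal.ofReal (Real.exp (-((ξ ⬝ᵥ V *ᵥ ξ) / s))) := fun s =>
    lintegral_sub_right_eq_self
      (fun ξ => ENNReal.ofReal (Real.exp (-((ξ ⬝ᵥ V *ᵥ ξ) / s)))) (posteriorMean D σ h)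
  have hc : Continuous fun ξ : Fin d → ℝ => ξ ⬝ᵥ V *ᵥ ξ :=
    Continuous.dotProduct continuous_id (Continuous.matrix_mulVec continuous_const continuous_id)
  rw [key, key, lintegral_comp_smul_fin d (c := √2) (by positivity) _ (by fun_prop)]
  congr 1
  refine lintegral_congr fun ξ => ?_
  rw [mulVec_smul, smul_dotProduct, dotProduct_smul, smul_eq_mul, smul_eq_mul, ← mul_assoc,
    Real.mul_self_sqrt zero_le_two]
  congr 3
  ring

/-- Serves to give joint measurability; the inverse is continuous as adjugate over a determinant
that never vanishes. -/
lemma continuous_deviation :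
    Continuous fun p : (Fin d → ℝ) × (Fin t → EuclideanSpace ℝ (Fin d) × ℝ) =>
      deviation D σ p.2 p.1 := by
  have hb : ∀ i : Fin t, Continuous fun h : Fin t → EuclideanSpace ℝ (Fin d) × ℝ =>
      direction D σ (h i).1 := by
    intro i
    have h1 : Continuous fun h : Fin t → EuclideanSpace ℝ (Fin d) × ℝ => (h i).1.ofLp := by
      fun_prop
    exact (continuous_const.matrix_mulVec h1).const_smul σ⁻¹
  have hr : ∀ i : Fin t, Continuous fun h : Fin t → EuclideanSpace ℝ (Fin d) × ℝ =>
      σ⁻¹ * (h i).2 := fun i => by fun_prop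
  have hV : Continuous fun h : Fin t → EuclideanSpace ℝ (Fin d) × ℝ =>
      posteriorPrecision D σ h :=
    continuous_const.add (continuous_finsetSum _ fun i _ => (hb i).matrix_vecMulVec (hb i))
  have hI : Continuous fun h : Fin t → EuclideanSpace ℝ (Fin d) × ℝ =>
      (posteriorPrecision D σ h)⁻¹ := by
    simp_rw [Matrix.inv_def, Ring.inverse_eq_inv']
    exact (hV.matrix_det.inv₀ fun h => (posteriorPrecision_posDef h).det_pos.ne').smul
      hV.matrix_adjugate
  have hμ : Continuous fun h : Fin t → EuclideanSpace ℝ (Fin d) × ℝ => posteriorMean D σ h :=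
    hI.matrix_mulVec (continuous_finsetSum _ fun i _ => (hr i).smul (hb i))
  have hs := continuous_fst.sub (hμ.comp (continuous_snd (X := Fin d → ℝ)))
  exact hs.dotProduct ((hV.comp continuous_snd).matrix_mulVec hs)

end Deviation

/-! ### Exponential moments of the deviations. -/

section Posterior

variable {d : ℕ} {Ω : Type*} [MeasurableSpace Ω] {S₀ : Matrix (Fin d) (Fin d) ℝ} {σ : ℝ}
  {aStar : EuclideanSpace ℝ (Fin d) → EuclideanSpace ℝ (Fin d)} {P : Measure Ω}
  [IsProbabilityMeasure P] {θ : Ω → EuclideanSpace ℝ (Fin d)} {W : ℕ → Ω → ℝ}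
  {θhat : ℕ → Ω → EuclideanSpace ℝ (Fin d)}

lemma sqrt_posDef (hS : S₀.PosDef) : (CFC.sqrt S₀).PosDef := by
  have h : CFC.sqrt S₀ * CFC.sqrt S₀ = S₀ := CFC.sqrt_mul_sqrt_self S₀ hS.posSemidef.nonneg
  have hp : (CFC.sqrt S₀).PosSemidef := Matrix.nonneg_iff_posSemidef.1 (CFC.sqrt_nonneg S₀)
  refine hp.posDef_iff_isUnit.2 ?_
  have hu := hS.isUnit
  rw [← h] at hu
  exact isUnit_of_mul_isUnit_left hu

/-- The deviation as a function of the parameter rather than of the whitened parameter. -/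
noncomputable def paramDeviation (S₀ : Matrix (Fin d) (Fin d) ℝ) (σ : ℝ) {t : ℕ}
    (h : Fin t → EuclideanSpace ℝ (Fin d) × ℝ) (x : EuclideanSpace ℝ (Fin d)) : ℝ :=
  deviation (CFC.sqrt S₀) σ h ((CFC.sqrt S₀)⁻¹ *ᵥ x.ofLp)

lemma measurable_paramDeviation (t : ℕ) :
    Measurable fun p : EuclideanSpace ℝ (Fin d) × (Fin t → EuclideanSpace ℝ (Fin d) × ℝ) =>
      paramDeviation S₀ σ p.2 p.1 := by
  have h : Continuous fun p : EuclideanSpace ℝ (Fin d) ×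
      (Fin t → EuclideanSpace ℝ (Fin d) × ℝ) => ((CFC.sqrt S₀)⁻¹ *ᵥ p.1.ofLp, p.2) :=
    (Continuous.matrix_mulVec continuous_const (by fun_prop)).prodMk continuous_snd
  exact ((continuous_deviation (D := CFC.sqrt S₀) (σ := σ)).comp h).measurable

namespace IsThompsonSampling

/-- This is the moment generating function of χ² with d degrees of freedom at 1/4. It is computed
history by history from the joint density, without identifying the conditional law. -/
lemma lintegral_exp_deviation_param (hTS : IsThompsonSampling S₀ σ aStar P θ W θhat)
    (ha : Measurable aStar) (hσ : 0 < σ) (hS : S₀.PosDef) (t : ℕ) :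
    ∫⁻ ω, ENNReal.ofReal (Real.exp (paramDeviation S₀ σ
      (history θ (thompsonAction aStar θhat) W t ω) (θ ω) / 4)) ∂P = ENNReal.ofReal (√2 ^ d) := by
  obtain ⟨ν, hν, h⟩ := hTS.exists_lintegral_history ha hσ t
  have hDp := sqrt_posDef hS
  have hm := measurable_paramDeviation (S₀ := S₀) (σ := σ) t
  have hdev : ∀ (g : Fin t → EuclideanSpace ℝ (Fin d) × ℝ) ξ,
      paramDeviation S₀ σ g (WithLp.toLp 2 (CFC.sqrt S₀ *ᵥ ξ)) = deviation (CFC.sqrt S₀) σ g ξ := by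
    intro g ξ
    rw [paramDeviation, posDef_inv_mulVec_mulVec hDp]
  have hj := measurable_jointDensity (CFC.sqrt S₀) σ t
  have hd : Measurable fun p : (Fin d → ℝ) × (Fin t → EuclideanSpace ℝ (Fin d) × ℝ) =>
    deviation (CFC.sqrt S₀) σ p.2 p.1 := continuous_deviation.measurable
  -- Total mass one supplies the normalisation, so the constant `c` of each history never has to be
  -- evaluated.
  have hone := h (fun _ => 1) measurable_const
  rw [lintegral_one, measure_univ] at hone
  have h1 := h (fun p => ENNReal.ofReal (Real.exp (paramDeviation S₀ σ p.2 p.1 / 4)))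
    (by fun_prop)
  rw [h1]
  simp_rw [hdev]
  rw [lintegral_lintegral_swap (by fun_prop)]
  simp_rw [one_mul] at hone
  rw [lintegral_lintegral_swap hj.aemeasurable] at hone
  rw [← mul_one (ENNReal.ofReal (√2 ^ d)), hone, ← lintegral_const_mul' _ _ ENNReal.ofReal_ne_top]
  refine lintegral_congr fun g => ?_
  obtain ⟨c, hc⟩ := exists_jointDensity_eq hDp.isHermitian hσ g
  have hg : Measurable fun ξ => deviation (CFC.sqrt S₀) σ g ξ :=
    (continuous_deviation.comp (by fun_prop : Continuous fun ξ : Fin d → ℝ => (ξ, g))).measurable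
  simp_rw [hc]
  rw [lintegral_const_mul _ (by fun_prop), mul_left_comm, ← lintegral_exp_deviation,
    ← lintegral_const_mul _ (by fun_prop)]
  refine lintegral_congr fun ξ => ?_
  rw [mul_left_comm, ← ENNReal.ofReal_mul (Real.exp_pos _).le, ← Real.exp_add]
  congr 3
  ring

lemma lintegral_exp_deviation_sample (hTS : IsThompsonSampling S₀ σ aStar P θ W θhat)
    (ha : Measurable aStar) (hσ : 0 < σ) (hS : S₀.PosDef) (t : ℕ) :
    ∫⁻ ω, ENNReal.ofReal (Real.exp (paramDeviation S₀ σ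
      (history θ (thompsonAction aStar θhat) W t ω) (θhat t ω) / 4)) ∂P =
        ENNReal.ofReal (√2 ^ d) := by
  rw [← hTS.lintegral_exp_deviation_param ha hσ hS t]
  have hH := hTS.measurable_history ha t
  have hθ := hTS.measurable_param
  have hz := hTS.measurable_sample t
  have hm := (measurable_paramDeviation (S₀ := S₀) (σ := σ) (d := d) t).comp measurable_swap
  have hf : Measurable fun p : (Fin t → EuclideanSpace ℝ (Fin d) × ℝ) ×
      EuclideanSpace ℝ (Fin d) => ENNReal.ofReal (Real.exp (paramDeviation S₀ σ p.1 p.2 / 4)) :=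
    ENNReal.measurable_ofReal.comp (Real.measurable_exp.comp (hm.div_const 4))
  have h1 := lintegral_map hf (hH.prodMk hz) (μ := P)
  have h2 := lintegral_map hf (hH.prodMk hθ) (μ := P)
  rw [← h1, ← h2, hTS.map_sample_eq ha t]

end IsThompsonSampling

end Posterior

/-! ### Pathwise inequalities and choice of weights. -/

section Deterministic

variable {d : ℕ} {S₀ : Matrix (Fin d) (Fin d) ℝ} {σ : ℝ}

lemma inv_sqrt_dotProduct_direction (hS : S₀.PosDef)
    (x a : EuclideanSpace ℝ (Fin d)) :
    ((CFC.sqrt S₀)⁻¹ *ᵥ x.ofLp) ⬝ᵥ direction (CFC.sqrt S₀) σ a = σ⁻¹ * inner ℝ x a := by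
  rw [dotProduct_direction (sqrt_posDef hS).isHermitian, posDef_mulVec_inv_mulVec (sqrt_posDef hS)]

lemma dotProduct_direction_self_le (hS : S₀.PosDef) {r : ℝ}
    {a : EuclideanSpace ℝ (Fin d)} (ha : ‖a‖ ≤ r) :
    direction (CFC.sqrt S₀) σ a ⬝ᵥ direction (CFC.sqrt S₀) σ a ≤
      r ^ 2 * ‖Matrix.toEuclideanCLM (𝕜 := ℝ) S₀‖ / σ ^ 2 := by
  have h : CFC.sqrt S₀ * CFC.sqrt S₀ = S₀ := CFC.sqrt_mul_sqrt_self S₀ hS.posSemidef.nonneg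
  have h1 : direction (CFC.sqrt S₀) σ a ⬝ᵥ direction (CFC.sqrt S₀) σ a =
      inner ℝ a (Matrix.toEuclideanCLM (𝕜 := ℝ) S₀ a) / σ ^ 2 := by
    rw [inner_toEuclideanCLM, direction, smul_dotProduct, dotProduct_smul,
      ← isHermitian_dotProduct_mulVec (sqrt_posDef hS).isHermitian, mulVec_mulVec, h]
    simp only [smul_eq_mul]
    ring
  rw [h1]
  gcongr
  calc inner ℝ a (Matrix.toEuclideanCLM (𝕜 := ℝ) S₀ a)
      ≤ ‖a‖ * (‖Matrix.toEuclideanCLM (𝕜 := ℝ) S₀‖ * ‖a‖) :=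
        (real_inner_le_norm _ _).trans (by gcongr; exact ContinuousLinearMap.le_opNorm _ _)
    _ ≤ r * (‖Matrix.toEuclideanCLM (𝕜 := ℝ) S₀‖ * r) := by
        have := (norm_nonneg a).trans ha
        gcongr
    _ = _ := by ring

lemma inner_sub_inner_le (hS : S₀.PosDef) (hσ : 0 < σ) {t : ℕ}
    (h : Fin t → EuclideanSpace ℝ (Fin d) × ℝ) (x y a : EuclideanSpace ℝ (Fin d)) {l : ℝ}
    (hl : 0 < l) :
    inner ℝ x a - inner ℝ y a ≤ σ * (l / 2 * (paramDeviation S₀ σ h x + paramDeviation S₀ σ h y) +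
      direction (CFC.sqrt S₀) σ a ⬝ᵥ (posteriorPrecision (CFC.sqrt S₀) σ h)⁻¹ *ᵥ
        direction (CFC.sqrt S₀) σ a / l) := by
  have hV := posteriorPrecision_posDef (D := CFC.sqrt S₀) (σ := σ) h
  set b := direction (CFC.sqrt S₀) σ a with hb
  set μ := posteriorMean (CFC.sqrt S₀) σ h with hμ
  -- Split the difference at the posterior mean μ and apply Cauchy–Schwarz to each half.
  have h1 := dotProduct_le_of_posDef hV ((CFC.sqrt S₀)⁻¹ *ᵥ x.ofLp - μ) b hl
  have h2 := dotProduct_le_of_posDef hV (μ - (CFC.sqrt S₀)⁻¹ *ᵥ y.ofLp) b hl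
  have h3 : (μ - (CFC.sqrt S₀)⁻¹ *ᵥ y.ofLp) ⬝ᵥ posteriorPrecision (CFC.sqrt S₀) σ h *ᵥ
      (μ - (CFC.sqrt S₀)⁻¹ *ᵥ y.ofLp) = paramDeviation S₀ σ h y := by
    rw [← neg_sub, mulVec_neg, neg_dotProduct_neg]
    rfl
  have h4 : ((CFC.sqrt S₀)⁻¹ *ᵥ x.ofLp - μ) ⬝ᵥ posteriorPrecision (CFC.sqrt S₀) σ h *ᵥ
      ((CFC.sqrt S₀)⁻¹ *ᵥ x.ofLp - μ) = paramDeviation S₀ σ h x := rfl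
  rw [sub_dotProduct, inv_sqrt_dotProduct_direction hS] at h1 h2
  rw [h3] at h2
  rw [h4] at h1
  have h5 : inner ℝ x a - inner ℝ y a = σ * (σ⁻¹ * inner ℝ x a - σ⁻¹ * inner ℝ y a) := by
    field_simp
  rw [h5]
  refine mul_le_mul_of_nonneg_left ?_ hσ.le
  have h6 : b ⬝ᵥ (posteriorPrecision (CFC.sqrt S₀) σ h)⁻¹ *ᵥ b / l =
    b ⬝ᵥ (posteriorPrecision (CFC.sqrt S₀) σ h)⁻¹ *ᵥ b / (2 * l) +
    b ⬝ᵥ (posteriorPrecision (CFC.sqrt S₀) σ h)⁻¹ *ᵥ b / (2 * l) := by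
    field_simp; ring
  rw [h6]
  linarith

/-- The tangent-line bound u + 1 ≤ exp u at u = (q - B)/4. It acts as a truncation at level B whose
error has finite expectation. -/
lemma le_add_mul_exp (q B : ℝ) : q ≤ B + 4 * Real.exp (-(B / 4)) * Real.exp (q / 4) := by
  have h := Real.add_one_le_exp (-(B / 4) + q / 4)
  rw [Real.exp_add] at h
  linarith

/-- The sum of quantities that are bounded in terms of a variance `x t` and a deviation `q t`, with
a weight of one's choice. Small and large variances use the weights `l` and `m`; the deviations are
replaced by the thresholds `B₁` and `B₂`, up to exponentially small multiples of `G t`. -/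
lemma sum_le_of_weighted_bounds {T : ℕ} {y x q G : ℕ → ℝ} {l m B₁ B₂ M R : ℝ}
    (hl : 0 < l) (hm : 0 < m) (hB₂ : 0 ≤ B₂) (hx : ∀ t, 0 ≤ x t) (hG : ∀ t, 0 ≤ G t)
    (hy : ∀ t, ∀ s > 0, y t ≤ s / 2 * q t + x t / s)
    (hq : ∀ t B, q t ≤ 2 * B + 4 * Real.exp (-(B / 4)) * G t)
    (hB₁ : 0 ≤ B₁)
    (hM : ∑ t ∈ Finset.range T, min (x t) 1 ≤ M)
    (hR : ∑ t ∈ Finset.range T, (if 1 < x t then x t else 0) ≤ R) :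
    ∑ t ∈ Finset.range T, y t ≤
      l * (T * B₁ + 2 * Real.exp (-(B₁ / 4)) * ∑ t ∈ Finset.range T, G t) + M / l +
        (m * (B₂ * M + 2 * Real.exp (-(B₂ / 4)) * ∑ t ∈ Finset.range T, G t) + R / m) := by
  have step : ∀ t, y t ≤ l * (B₁ + 2 * Real.exp (-(B₁ / 4)) * G t) + min (x t) 1 / l +
      (m * (B₂ * min (x t) 1 + 2 * Real.exp (-(B₂ / 4)) * G t) +
        (if 1 < x t then x t else 0) / m) := by
    intro t
    have hG' := hG t
    have hx' := hx t
    have hmin : 0 ≤ min (x t) 1 := le_min hx' zero_le_one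
    split_ifs with h
    -- In a large round min(x, 1) = 1, so the threshold `B₂` may be charged to the potential: `B₂`
    -- is paid at most `M` times rather than `T` times.
    · have h1 := hy t m hm
      have h2 := mul_le_mul_of_nonneg_left (hq t B₂) (half_pos hm).le
      have h3 : 0 ≤ l * (B₁ + 2 * Real.exp (-(B₁ / 4)) * G t) + min (x t) 1 / l := by positivity
      rw [min_eq_right h.le] at h3 ⊢
      linarith
    · have h1 := hy t l hl
      have h2 := mul_le_mul_of_nonneg_left (hq t B₁) (half_pos hl).le
      have h3 : 0 ≤ m * (B₂ * min (x t) 1 + 2 * Real.exp (-(B₂ / 4)) * G t) := by positivity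
      rw [min_eq_left (not_lt.1 h)] at h3 ⊢
      simp only [zero_div]
      linarith
  refine (Finset.sum_le_sum fun t _ => step t).trans ?_
  simp only [Finset.sum_add_distrib, ← Finset.mul_sum, ← Finset.sum_div, Finset.sum_const,
    Finset.card_range, nsmul_eq_mul]
  gcongr

lemma le_two_mul_sqrt {X A B : ℝ} (hA : 0 < A) (hB : 0 ≤ B)
    (h : ∀ l > 0, X ≤ l * A + B / l) : X ≤ 2 * √(A * B) := by
  rcases hB.eq_or_lt with rfl | hB
  -- For B = 0 the optimal weight would be 0, which is not allowed; small weights show X ≤ 0.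
  · simp only [zero_div, add_zero, mul_zero, Real.sqrt_zero] at h ⊢
    by_contra! hX
    have := h (X / (2 * A)) (by positivity)
    have h1 : X / (2 * A) * A = X / 2 := by field_simp
    linarith
  · have hs : 0 < √(A * B) := by positivity
    have h1 := h (√(A * B) / A) (by positivity)
    have h2 : √(A * B) / A * A = √(A * B) := by field_simp
    have h3 : B / (√(A * B) / A) = √(A * B) := by
      rw [div_div_eq_mul_div, div_eq_iff hs.ne', Real.mul_self_sqrt (by positivity), mul_comm]
    linarith

end Deterministic

/-! ### Regret as a difference of posterior draws; integrability. -/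

section Regret

variable {d : ℕ} {Ω : Type*} [MeasurableSpace Ω] {S₀ : Matrix (Fin d) (Fin d) ℝ} {σ : ℝ}
  {aStar : EuclideanSpace ℝ (Fin d) → EuclideanSpace ℝ (Fin d)} {P : Measure Ω}
  [IsProbabilityMeasure P] {θ : Ω → EuclideanSpace ℝ (Fin d)} {W : ℕ → Ω → ℝ}
  {θhat : ℕ → Ω → EuclideanSpace ℝ (Fin d)}

namespace IsThompsonSampling

lemma integrable_inner (hTS : IsThompsonSampling S₀ σ aStar P θ W θhat) {r : ℝ}
    {A : Ω → EuclideanSpace ℝ (Fin d)} (hA : Measurable A) (hr : ∀ ω, ‖A ω‖ ≤ r) :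
    Integrable (fun ω => (inner ℝ (θ ω) (A ω) : ℝ)) P := by
  have hθ : Integrable θ P := by
    have h : Integrable id (P.map θ) := by
      rw [hTS.prior.map_eq]
      exact IsGaussian.integrable_id
    exact h.comp_measurable hTS.measurable_param
  refine Integrable.mono' (hθ.norm.mul_const r)
    (hTS.measurable_param.inner hA).aestronglyMeasurable (ae_of_all _ fun ω => ?_)
  exact (norm_inner_le_norm _ _).trans (by gcongr; exact hr ω)

lemma integrable_noise (hTS : IsThompsonSampling S₀ σ aStar P θ W θhat) (t : ℕ) :
    Integrable (W (t + 1)) P := by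
  have h : Integrable id (P.map (W (t + 1))) := by
    rw [(hTS.noise t).map_eq]
    exact IsGaussian.integrable_id
  exact h.comp_measurable (hTS.measurable_noise t)

lemma integral_noise (hTS : IsThompsonSampling S₀ σ aStar P θ W θhat) (t : ℕ) :
    ∫ ω, W (t + 1) ω ∂P = 0 := by
  rw [(hTS.noise t).integral_eq]
  simp

lemma map_sample (hTS : IsThompsonSampling S₀ σ aStar P θ W θhat) (ha : Measurable aStar)
    (t : ℕ) : P.map (θhat t) = P.map θ := by
  have hH := hTS.measurable_history ha t
  have h := congrArg (Measure.map Prod.snd) (hTS.map_sample_eq ha t)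
  rwa [Measure.map_map measurable_snd (hH.prodMk (hTS.measurable_sample t)),
    Measure.map_map measurable_snd (hH.prodMk hTS.measurable_param)] at h

lemma integrable_instantRegret (hTS : IsThompsonSampling S₀ σ aStar P θ W θhat)
    (ha : Measurable aStar) {r : ℝ} (hr : ∀ x, ‖aStar x‖ ≤ r) (t : ℕ) :
    Integrable (instantRegret aStar θ (thompsonAction aStar θhat) W t) P :=
  (hTS.integrable_inner (ha.comp hTS.measurable_param) fun _ => hr _).sub
    ((hTS.integrable_inner (hTS.measurable_action ha t) fun _ => hr _).add (hTS.integrable_noise t))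

/-- The noise is centred, and θ̂_t has the law of θ, so the optimal value θᵀa⋆(θ) may be replaced in
expectation by θ̂_tᵀA_t. Afterwards only the action actually played appears. -/
lemma integral_instantRegret (hTS : IsThompsonSampling S₀ σ aStar P θ W θhat)
    (ha : Measurable aStar) {r : ℝ} (hr : ∀ x, ‖aStar x‖ ≤ r) (t : ℕ) :
    Integrable (fun ω => (inner ℝ (θhat t ω) (thompsonAction aStar θhat t ω) : ℝ) -
        inner ℝ (θ ω) (thompsonAction aStar θhat t ω)) P ∧
      ∫ ω, instantRegret aStar θ (thompsonAction aStar θhat) W t ω ∂P =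
        ∫ ω, ((inner ℝ (θhat t ω) (thompsonAction aStar θhat t ω) : ℝ) -
          inner ℝ (θ ω) (thompsonAction aStar θhat t ω)) ∂P := by
  have h1 := hTS.integrable_inner (ha.comp hTS.measurable_param) fun ω => hr _
  have h2 := hTS.integrable_inner (hTS.measurable_action ha t) fun ω => hr _
  have h3 := hTS.integrable_noise t
  have hm : Measurable fun x : EuclideanSpace ℝ (Fin d) => (inner ℝ x (aStar x) : ℝ) :=
    measurable_id.inner ha
  have hz := hTS.measurable_sample t
  have h4 : Integrable (fun ω => (inner ℝ (θhat t ω) (thompsonAction aStar θhat t ω) : ℝ)) P := by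
    have h := (integrable_map_measure hm.aestronglyMeasurable
      hTS.measurable_param.aemeasurable).2 h1
    rw [← hTS.map_sample ha t] at h
    exact h.comp_measurable hz
  have h5 : ∫ ω, (inner ℝ (θhat t ω) (thompsonAction aStar θhat t ω) : ℝ) ∂P =
      ∫ ω, (inner ℝ (θ ω) (aStar (θ ω)) : ℝ) ∂P := by
    have e1 := integral_map hz.aemeasurable (hm.aestronglyMeasurable (μ := P.map (θhat t)))
    have e2 := integral_map hTS.measurable_param.aemeasurable
      (hm.aestronglyMeasurable (μ := P.map θ))
    rw [hTS.map_sample ha t] at e1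
    exact e1.symm.trans e2
  refine ⟨h4.sub h2, ?_⟩
  have h6 : ∫ ω, instantRegret aStar θ (thompsonAction aStar θhat) W t ω ∂P =
      ∫ ω, (inner ℝ (θ ω) (aStar (θ ω)) : ℝ) ∂P -
        (∫ ω, (inner ℝ (θ ω) (thompsonAction aStar θhat t ω) : ℝ) ∂P + ∫ ω, W (t + 1) ω ∂P) := by
    rw [← integral_add h2 h3]
    exact integral_sub h1 (h2.add h3)
  rw [h6, hTS.integral_noise, integral_sub h4 h2, h5, add_zero]

lemma integrable_exp_deviation (hTS : IsThompsonSampling S₀ σ aStar P θ W θhat)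
    (ha : Measurable aStar) (hσ : 0 < σ) (hS : S₀.PosDef) (t : ℕ) :
    Integrable (fun ω =>
        Real.exp (paramDeviation S₀ σ (history θ (thompsonAction aStar θhat) W t ω) (θhat t ω) / 4) +
        Real.exp (paramDeviation S₀ σ (history θ (thompsonAction aStar θhat) W t ω) (θ ω) / 4)) P ∧
      ∫ ω, (Real.exp
          (paramDeviation S₀ σ (history θ (thompsonAction aStar θhat) W t ω) (θhat t ω) / 4) +
        Real.exp (paramDeviation S₀ σ (history θ (thompsonAction aStar θhat) W t ω) (θ ω) / 4)) ∂P =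
        2 * √2 ^ d := by
  have hH := hTS.measurable_history ha t
  have key : ∀ Y : Ω → EuclideanSpace ℝ (Fin d), Measurable Y →
      ∫⁻ ω, ENNReal.ofReal (Real.exp (paramDeviation S₀ σ
        (history θ (thompsonAction aStar θhat) W t ω) (Y ω) / 4)) ∂P = ENNReal.ofReal (√2 ^ d) →
      Integrable (fun ω => Real.exp (paramDeviation S₀ σ
        (history θ (thompsonAction aStar θhat) W t ω) (Y ω) / 4)) P ∧
      ∫ ω, Real.exp (paramDeviation S₀ σ
        (history θ (thompsonAction aStar θhat) W t ω) (Y ω) / 4) ∂P = √2 ^ d := by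
    intro Y hY h
    have hm : Measurable fun ω => Real.exp (paramDeviation S₀ σ
        (history θ (thompsonAction aStar θhat) W t ω) (Y ω) / 4) :=
      Real.measurable_exp.comp
        (((measurable_paramDeviation t).comp (hY.prodMk hH)).div_const 4)
    have h0 : 0 ≤ᵐ[P] fun ω => Real.exp (paramDeviation S₀ σ
        (history θ (thompsonAction aStar θhat) W t ω) (Y ω) / 4) :=
      ae_of_all _ fun ω => (Real.exp_pos _).le
    refine ⟨(lintegral_ofReal_ne_top_iff_integrable hm.aestronglyMeasurable h0).1
      (h ▸ ENNReal.ofReal_ne_top), ?_⟩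
    rw [integral_eq_lintegral_of_nonneg_ae h0 hm.aestronglyMeasurable, h,
      ENNReal.toReal_ofReal (by positivity)]
  have h1 := key _ (hTS.measurable_sample t) (hTS.lintegral_exp_deviation_sample ha hσ hS t)
  have h2 := key _ hTS.measurable_param (hTS.lintegral_exp_deviation_param ha hσ hS t)
  refine ⟨h1.1.add h2.1, ?_⟩
  rw [integral_add h1.1 h2.1, h1.2, h2.2, two_mul]

end IsThompsonSampling

end Regret

/-! ### Assembling the regret bound. -/

section Bound

lemma regret_terms_le {d T K L σ r τ A₁ A₂ M : ℝ} (hd : 1 ≤ d) (hT : 1 ≤ T) (hσ : 0 < σ)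
    (hr : 0 ≤ r) (hτ : 0 ≤ τ) (hK : 1 ≤ K) (hL : 1 ≤ L)
    (hM : 0 ≤ M) (h₁ : A₁ ≤ 6 * (d * T)) (h₂ : A₂ ≤ 4 * (d * K) * M + 4) (hML : M ≤ 2 * (d * L)) :
    σ * (2 * √(A₁ * M) + 2 * √(A₂ * (2 * r ^ 2 * (τ / σ ^ 2)))) ≤
      10 * (√K * √L) * (σ * d * √T + d * r * √τ) := by
  have hK0 : 0 ≤ K := by linarith
  have hL0 : 0 ≤ L := by linarith
  have hd0 : 0 ≤ d := by linarith
  have hT0 : 0 ≤ T := by linarith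
  have hs1 : √(A₁ * M) ≤ 5 * (√K * √L * (d * √T)) := by
    refine Real.sqrt_le_iff.2 ⟨by positivity, ?_⟩
    have h3 : (5 * (√K * √L * (d * √T))) ^ 2 = 25 * (K * (L * (d ^ 2 * T))) := by
      simp only [mul_pow]
      rw [Real.sq_sqrt hK0, Real.sq_sqrt hL0, Real.sq_sqrt hT0]
      ring
    have h4 : 1 * (L * (d ^ 2 * T)) ≤ K * (L * (d ^ 2 * T)) := by gcongr
    have h5 : 0 ≤ L * (d ^ 2 * T) := by positivity
    rw [h3]
    calc A₁ * M ≤ 6 * (d * T) * (2 * (d * L)) := by gcongr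
      _ = 12 * (L * (d ^ 2 * T)) := by ring
      _ ≤ _ := by linarith
  have hs2 : √(A₂ * (2 * r ^ 2 * (τ / σ ^ 2))) ≤ 5 * (√K * √L * (d * r * √τ)) / σ := by
    refine Real.sqrt_le_iff.2 ⟨by positivity, ?_⟩
    have h2' : 4 * (d * K) * M ≤ 4 * (d * K) * (2 * (d * L)) := by gcongr
    -- Absorbs the additive 4 of `A₂`.
    have h3 : 1 ≤ (d * K) * (d * L) :=
      one_le_mul_of_one_le_of_one_le (one_le_mul_of_one_le_of_one_le hd hK)
        (one_le_mul_of_one_le_of_one_le hd hL)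
    have h4 : A₂ ≤ 12 * (d * K * (d * L)) := by linarith
    have h5 : (5 * (√K * √L * (d * r * √τ)) / σ) ^ 2 =
        25 * (K * L * (d ^ 2 * r ^ 2 * τ) / σ ^ 2) := by
      simp only [mul_pow, div_pow]
      rw [Real.sq_sqrt hK0, Real.sq_sqrt hL0, Real.sq_sqrt hτ]
      ring
    have h8 : 0 ≤ K * L * (d ^ 2 * r ^ 2 * τ) / σ ^ 2 := by positivity
    rw [h5]
    calc A₂ * (2 * r ^ 2 * (τ / σ ^ 2)) ≤ 12 * (d * K * (d * L)) * (2 * r ^ 2 * (τ / σ ^ 2)) := by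
          gcongr
      _ = 24 * (K * L * (d ^ 2 * r ^ 2 * τ) / σ ^ 2) := by ring
      _ ≤ _ := by linarith
  calc σ * (2 * √(A₁ * M) + 2 * √(A₂ * (2 * r ^ 2 * (τ / σ ^ 2))))
      ≤ σ * (2 * (5 * (√K * √L * (d * √T))) +
          2 * (5 * (√K * √L * (d * r * √τ)) / σ)) := by gcongr
    _ = 10 * (√K * √L) * (σ * d * √T + d * r * √τ) := by
        field_simp
        norm_num

variable {d : ℕ} {Ω : Type*} [MeasurableSpace Ω] {S₀ : Matrix (Fin d) (Fin d) ℝ} {σ : ℝ}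
  {aStar : EuclideanSpace ℝ (Fin d) → EuclideanSpace ℝ (Fin d)} {P : Measure Ω}
  [IsProbabilityMeasure P] {θ : Ω → EuclideanSpace ℝ (Fin d)} {W : ℕ → Ω → ℝ}
  {θhat : ℕ → Ω → EuclideanSpace ℝ (Fin d)}

lemma sum_inner_sub_inner_le (hS : S₀.PosDef) (hσ : 0 < σ) (hd : 1 ≤ d) {r : ℝ}
    {A : ℕ → EuclideanSpace ℝ (Fin d)} (hA : ∀ t, ‖A t‖ ≤ r) (R : ℕ → ℝ)
    (x : ℕ → EuclideanSpace ℝ (Fin d)) (y : EuclideanSpace ℝ (Fin d)) (T : ℕ)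
    {l m B₁ B₂ : ℝ} (hl : 0 < l) (hm : 0 < m) (hB₁ : 0 ≤ B₁) (hB₂ : 0 ≤ B₂) {G : ℕ → ℝ}
    (hG : ∀ t, G t = Real.exp (paramDeviation S₀ σ (fun i : Fin t => (A i, R i)) (x t) / 4) +
      Real.exp (paramDeviation S₀ σ (fun i : Fin t => (A i, R i)) y / 4)) {M : ℝ}
    (hM : M = 2 * (d * Real.log
      (1 + r ^ 2 * ‖Matrix.toEuclideanCLM (𝕜 := ℝ) S₀‖ / σ ^ 2 * T / d))) :
    ∑ t ∈ Finset.range T, (inner ℝ (x t) (A t) - inner ℝ y (A t)) ≤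
      σ * (l * (T * B₁ + 2 * Real.exp (-(B₁ / 4)) * ∑ t ∈ Finset.range T, G t) + M / l +
        (m * (B₂ * M + 2 * Real.exp (-(B₂ / 4)) * ∑ t ∈ Finset.range T, G t) +
          2 * r ^ 2 * (S₀.trace / σ ^ 2) / m)) := by
  set b : ℕ → Fin d → ℝ := fun t => direction (CFC.sqrt S₀) σ (A t) with hb
  have hDh := (sqrt_posDef hS).isHermitian
  have hsq : CFC.sqrt S₀ * CFC.sqrt S₀ = S₀ := CFC.sqrt_mul_sqrt_self S₀ hS.posSemidef.nonneg
  have hDs : (σ⁻¹ • CFC.sqrt S₀).IsHermitian := hDh.smul (by simp [IsSelfAdjoint])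
  have htr : ((σ⁻¹ • CFC.sqrt S₀) * (σ⁻¹ • CFC.sqrt S₀)).trace = S₀.trace / σ ^ 2 := by
    rw [Matrix.smul_mul, Matrix.mul_smul, hsq, trace_smul, trace_smul, smul_eq_mul, smul_eq_mul]
    field_simp
  have ha : ∀ t, (A t).ofLp ⬝ᵥ (A t).ofLp ≤ r ^ 2 := by
    intro t
    have h1 : (A t).ofLp ⬝ᵥ (A t).ofLp = ‖A t‖ ^ 2 := by
      rw [EuclideanSpace.real_norm_sq_eq]
      simp [dotProduct, sq]
    rw [h1]
    exact pow_le_pow_left₀ (norm_nonneg _) (hA t) 2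
  -- Taken with D = σ⁻¹√S₀, so that D² has trace tr(S₀)/σ².
  have hR := sum_large_leverage_le hDs (b := b) (a := fun t => (A t).ofLp)
    (fun t => by simp [hb, direction, smul_mulVec]) ha T
  rw [htr] at hR
  have hMM := sum_min_leverage_le hd b T fun t => dotProduct_direction_self_le hS (hA t)
  rw [← hM] at hMM
  have key := sum_le_of_weighted_bounds (T := T)
    (y := fun t => σ⁻¹ * (inner ℝ (x t) (A t) - inner ℝ y (A t))) (x := leverage b)
    (q := fun t => paramDeviation S₀ σ (fun i : Fin t => (A i, R i)) (x t) +
      paramDeviation S₀ σ (fun i : Fin t => (A i, R i)) y) (G := G) hl hm hB₂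
    (leverage_nonneg b) (fun t => by rw [hG]; positivity)
    (fun t s hs => by
      rw [inv_mul_le_iff₀ hσ]
      exact inner_sub_inner_le hS hσ (fun i : Fin t => (A i, R i)) (x t) y (A t) hs)
    (fun t B => by
      rw [hG]
      have h1 := le_add_mul_exp (paramDeviation S₀ σ (fun i : Fin t => (A i, R i)) (x t)) B
      have h2 := le_add_mul_exp (paramDeviation S₀ σ (fun i : Fin t => (A i, R i)) y) B
      linarith)
    hB₁ hMM hR
  rwa [← Finset.mul_sum, inv_mul_le_iff₀ hσ] at key

namespace IsThompsonSampling

lemma bayesRegret_le_of_weights (hTS : IsThompsonSampling S₀ σ aStar P θ W θhat)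
    (ha : Measurable aStar) (hσ : 0 < σ) (hS : S₀.PosDef) (hd : 1 ≤ d) {r : ℝ}
    (hr : ∀ x, ‖aStar x‖ ≤ r) (T : ℕ)
    {l m B₁ B₂ : ℝ} (hl : 0 < l) (hm : 0 < m) (hB₁ : 0 ≤ B₁) (hB₂ : 0 ≤ B₂) {M : ℝ}
    (hM : M = 2 * (d * Real.log
      (1 + r ^ 2 * ‖Matrix.toEuclideanCLM (𝕜 := ℝ) S₀‖ / σ ^ 2 * T / d))) :
    bayesRegret aStar P θ (thompsonAction aStar θhat) W T ≤
      σ * (l * (T * B₁ + 2 * Real.exp (-(B₁ / 4)) * (T * (2 * √2 ^ d))) + M / l +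
        (m * (B₂ * M + 2 * Real.exp (-(B₂ / 4)) * (T * (2 * √2 ^ d))) +
          2 * r ^ 2 * (S₀.trace / σ ^ 2) / m)) := by
  have hreg := fun t => hTS.integral_instantRegret ha hr t
  have hexp := fun t => hTS.integrable_exp_deviation ha hσ hS t
  set G : ℕ → Ω → ℝ := fun t ω =>
    Real.exp (paramDeviation S₀ σ (history θ (thompsonAction aStar θhat) W t ω) (θhat t ω) / 4) +
    Real.exp (paramDeviation S₀ σ (history θ (thompsonAction aStar θhat) W t ω) (θ ω) / 4) with hG
  have hGi : Integrable (fun ω => ∑ t ∈ Finset.range T, G t ω) P :=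
    integrable_finsetSum _ fun t _ => (hexp t).1
  have hGs : ∫ ω, ∑ t ∈ Finset.range T, G t ω ∂P = T * (2 * √2 ^ d) := by
    rw [integral_finsetSum _ fun t _ => (hexp t).1, Finset.sum_congr rfl fun t _ => (hexp t).2]
    simp
  rw [bayesRegret, Finset.sum_congr rfl fun t _ => (hreg t).2,
    ← integral_finsetSum _ fun t _ => (hreg t).1, ← hGs]
  -- The weights are deterministic and the right-hand side is affine in ∑ G, so taking expectations
  -- only needs E ∑ G.
  have hpt := fun ω => sum_inner_sub_inner_le hS hσ hd (A := fun t => thompsonAction aStar θhat t ω)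
    (fun t => hr (θhat t ω)) (fun t => rewardAfter θ (thompsonAction aStar θhat) W t ω)
    (fun t => θhat t ω) (θ ω) T hl hm hB₁ hB₂ (G := fun t => G t ω) (fun t => rfl) hM
  refine (integral_mono (integrable_finsetSum _ fun t _ => (hreg t).1) ?_ hpt).trans_eq ?_
  · have h1 := fun c : ℝ => hGi.const_mul c
    exact (((((integrable_const _).add (h1 _)).const_mul l).add (integrable_const _)).add
      ((((integrable_const _).add (h1 _)).const_mul m).add (integrable_const _))).const_mul σ
  · have h1 : ∀ ω, σ * (l * (T * B₁ + 2 * Real.exp (-(B₁ / 4)) * ∑ t ∈ Finset.range T, G t ω) +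
        M / l + (m * (B₂ * M + 2 * Real.exp (-(B₂ / 4)) * ∑ t ∈ Finset.range T, G t ω) +
          2 * r ^ 2 * (S₀.trace / σ ^ 2) / m)) =
        σ * (l * (T * B₁) + M / l + (m * (B₂ * M) + 2 * r ^ 2 * (S₀.trace / σ ^ 2) / m)) +
        (σ * (l * (2 * Real.exp (-(B₁ / 4))) + m * (2 * Real.exp (-(B₂ / 4))))) *
          ∑ t ∈ Finset.range T, G t ω := fun ω => by ring
    simp_rw [h1]
    rw [integral_add (integrable_const _) (hGi.const_mul _), integral_const,
      probReal_univ, one_smul, integral_const_mul]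
    ring

lemma bayesRegret_le (hTS : IsThompsonSampling S₀ σ aStar P θ W θhat)
    (ha : Measurable aStar) (hσ : 0 < σ) (hS : S₀.PosDef) (hd : 1 ≤ d) {r : ℝ} (hr0 : 0 ≤ r)
    (hr : ∀ x, ‖aStar x‖ ≤ r) {T : ℕ} (hT : 1 ≤ T) :
    bayesRegret aStar P θ (thompsonAction aStar θhat) W T ≤
      10 * logFactor d T σ r S₀ * (σ * d * √T + d * r * √S₀.trace) := by
  have hd' : (1 : ℝ) ≤ d := by exact_mod_cast hd
  have hT' : (1 : ℝ) ≤ T := by exact_mod_cast hT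
  have hd0 : (0 : ℝ) < d := by linarith
  have hlogT : 0 ≤ Real.log T := Real.log_nonneg hT'
  have htr : 0 ≤ S₀.trace := hS.posSemidef.trace_nonneg
  have hlog2 : 0 ≤ Real.log 2 := Real.log_nonneg one_le_two
  have hlog2' : Real.log 2 ≤ 1 := by linarith [Real.log_two_lt_d9]
  set N := r ^ 2 * ‖Matrix.toEuclideanCLM (𝕜 := ℝ) S₀‖ * T / (d * σ ^ 2) with hN
  have hN' : r ^ 2 * ‖Matrix.toEuclideanCLM (𝕜 := ℝ) S₀‖ / σ ^ 2 * T / d = N := by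
    rw [hN]; field_simp
  have hN0 : 0 ≤ N := by positivity
  have hlogN : 0 ≤ Real.log (1 + N) := Real.log_nonneg (by linarith)
  set M : ℝ := 2 * (d * Real.log (1 + N)) with hM
  have hM0 : 0 ≤ M := by positivity
  set L := 1 + Real.log (1 + N) with hL
  set K := 1 + Real.log T / d with hK
  have hL1 : 1 ≤ L := by linarith
  have hK1 : 1 ≤ K := by have : 0 ≤ Real.log T / d := by positivity
                         linarith
  have hdK : d * K = d + Real.log T := by rw [hK]; field_simp
  -- Chosen so that exp(B₁/4) = √2^d, cancelling the exponential moment of one round.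
  set B₁ : ℝ := 2 * (d * Real.log 2) with hB₁
  -- The extra 4 log T also cancels the factor T from summing the truncation errors over all rounds,
  -- large or not.
  set B₂ : ℝ := 2 * (d * Real.log 2) + 4 * Real.log T with hB₂
  have he1 : Real.exp (-(B₁ / 4)) * √2 ^ d = 1 := by
    have : √2 ^ d = Real.exp (B₁ / 4) := by
      rw [hB₁, ← Real.exp_log (show 0 < √2 ^ d by positivity), Real.log_pow,
        Real.log_sqrt zero_le_two]
      congr 1
      ring
    rw [this, ← Real.exp_add, neg_add_cancel, Real.exp_zero]
  have he2 : Real.exp (-(B₂ / 4)) * (T * √2 ^ d) = 1 := by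
    have h1 : Real.exp (-(B₂ / 4)) = Real.exp (-(B₁ / 4)) * (T : ℝ)⁻¹ := by
      rw [← Real.exp_log (show (0 : ℝ) < (T : ℝ)⁻¹ by positivity), ← Real.exp_add, Real.log_inv]
      congr 1
      rw [hB₁, hB₂]
      ring
    rw [h1, mul_assoc, inv_mul_cancel_left₀ (by positivity), he1]
  set A₁ : ℝ := T * B₁ + 4 * T with hA₁
  set A₂ : ℝ := B₂ * M + 4 with hA₂
  set Q : ℝ := 2 * r ^ 2 * (S₀.trace / σ ^ 2) with hQ
  have hA₁0 : 0 < A₁ := by positivity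
  have hA₂0 : 0 < A₂ := by positivity
  have hQ0 : 0 ≤ Q := by positivity
  have hall : ∀ l > 0, ∀ m > 0,
      σ⁻¹ * bayesRegret aStar P θ (thompsonAction aStar θhat) W T ≤
        l * A₁ + M / l + (m * A₂ + Q / m) := by
    intro l hl m hm
    rw [inv_mul_le_iff₀ hσ]
    refine (hTS.bayesRegret_le_of_weights ha hσ hS hd hr T hl hm (B₁ := B₁) (B₂ := B₂) (M := M)
      (by positivity) (by positivity) (by rw [hN'])).trans_eq ?_
    have e1 : 2 * Real.exp (-(B₁ / 4)) * (T * (2 * √2 ^ d)) = 4 * T := by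
      linear_combination (4 * (T : ℝ)) * he1
    have e2 : 2 * Real.exp (-(B₂ / 4)) * (T * (2 * √2 ^ d)) = 4 := by
      linear_combination 4 * he2
    rw [e1, e2]
  have hmain : σ⁻¹ * bayesRegret aStar P θ (thompsonAction aStar θhat) W T ≤
      2 * √(A₁ * M) + 2 * √(A₂ * Q) := by
    -- Optimise over l with m fixed, then over m.
    have h1 : ∀ m > 0, σ⁻¹ * bayesRegret aStar P θ (thompsonAction aStar θhat) W T -
        2 * √(A₁ * M) ≤ m * A₂ + Q / m := by
      intro m hm
      have := le_two_mul_sqrt hA₁0 hM0 (X := σ⁻¹ * bayesRegret aStar P θ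
        (thompsonAction aStar θhat) W T - (m * A₂ + Q / m)) fun l hl => by
          linarith [hall l hl m hm]
      linarith
    linarith [le_two_mul_sqrt hA₂0 hQ0 h1]
  rw [inv_mul_le_iff₀ hσ] at hmain
  refine hmain.trans ?_
  have hdl : (d : ℝ) * Real.log 2 ≤ d := mul_le_of_le_one_right hd0.le hlog2'
  refine regret_terms_le hd' hT' hσ hr0 htr hK1 hL1 hM0 ?_ ?_ ?_
  · have h1 : (T : ℝ) ≤ d * T := le_mul_of_one_le_left (by linarith) hd'
    have h2 : T * (d * Real.log 2) ≤ T * (d : ℝ) := by gcongr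
    rw [hA₁, hB₁]
    linarith
  · have h1 : B₂ ≤ 4 * (d * K) := by rw [hdK, hB₂]; linarith
    rw [hA₂]
    gcongr
  · rw [hM]
    gcongr
    linarith

end IsThompsonSampling

end Bound

end LinearGaussianBandit

theorem mainTheorem3 :
    ∃ C : ℝ, 0 < C ∧
      ∀ (d T : ℕ) (σ r : ℝ) (S₀ : Matrix (Fin d) (Fin d) ℝ)
        (𝒜 : Set (EuclideanSpace ℝ (Fin d)))
        (aStar : EuclideanSpace ℝ (Fin d) → EuclideanSpace ℝ (Fin d))
        (Ω : Type*) [MeasurableSpace Ω] (P : Measure Ω) [IsProbabilityMeasure P]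
        (θ : Ω → EuclideanSpace ℝ (Fin d)) (W : ℕ → Ω → ℝ)
        (θhat : ℕ → Ω → EuclideanSpace ℝ (Fin d)),
        1 ≤ d → 1 ≤ T → 0 < σ → 0 ≤ r → S₀.PosDef →
        𝒜 ⊆ Metric.closedBall 0 r →
        LinearGaussianBandit.IsOptimalAction 𝒜 aStar →
        LinearGaussianBandit.IsThompsonSampling S₀ σ aStar P θ W θhat →
        (∀ t, Integrable (LinearGaussianBandit.instantRegret aStar θ
          (LinearGaussianBandit.thompsonAction aStar θhat) W t) P) ∧
        LinearGaussianBandit.bayesRegret aStar P θ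
            (LinearGaussianBandit.thompsonAction aStar θhat) W T
          ≤ C * LinearGaussianBandit.logFactor d T σ r S₀ *
            (σ * d * √T + d * r * √S₀.trace) := by
  refine ⟨10, by norm_num, ?_⟩
  intro d T σ r S₀ 𝒜 aStar Ω _ P _ θ W θhat hd hT hσ hr0 hS h𝒜 hopt hTS
  have hr : ∀ x, ‖aStar x‖ ≤ r := fun x => mem_closedBall_zero_iff.1 (h𝒜 (hopt.mem x))
  exact ⟨hTS.integrable_instantRegret hopt.measurable hr,
    hTS.bayesRegret_le hopt.measurable hσ hS hd hr0 hr hT⟩
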